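/- Let $\Omega=(\mathbb{R}/2\pi\mathbb{Z})^2$. Let $H$ be the Hilbert space of real-valued, mean-free, divergence-free vector fields in $L^2(\Omega)^2$, with norm $|u|^2=\int_\Omega|u(x)|^2\,dx$, let $\mathbb{P}$ be the orthogonal (Leray) projection of $L^2(\Omega)^2$ onto $H$, and let $V$ be the space of those $u\in H$ whose weak gradient is square integrable, with norm $\|u\|^2=\sum_{j=1,2}|\partial_j u|^2$. Let $A=-\mathbb{P}\Delta$ be the Stokes operator, with domain $D(A)\subset H$, let $B(u,v)=\mathbb{P}((u\cdot\nabla)v)$, and for real $N>0$ let $P_N$ be the projection of $H$ onto the Fourier wavenumbers $k\in\mathbb{Z}^2$ with $|k|\le N$. For $\nu>0$, $\mu>0$, $N>0$, $f\in L^\infty(0,\infty;H)$ and $v_0,u_0\in V$, consider the nudging filter $v$ together with the reference solution $u$ of the two-dimensional Navier–Stokes equations: $$\frac{dv}{dt}+\nu Av+B(v,v)=f-\mu P_Nv+\mu P_Nu,\quad v(0)=v_0,\qquad \frac{du}{dt}+\nu Au+B(u,u)=f,\quad u(0)=u_0,$$ where $(v,u)$ is a strong solution, i.e. $u,v\in C([0,T];V)\cap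 L^2(0,T;D(A))$ and $\frac{du}{dt},\frac{dv}{dt}\in L^2(0,T;H)$ for all $T>0$, the equations holding in $H$ for almost every $t>0$. Write $|f|_\infty=\operatorname{ess\,sup}_{t>0}|f(t)|$. **Theorem (synchronization property of the nudging filter).** There exist a strictly increasing function $\mu_*:(0,\infty)\to(0,\infty)$ and a continuous function $N_*:[0,\infty)\times(0,\infty)\to(0,\infty)$ such that the following holds. For every $\nu>0$ and every $f\in L^\infty(0,\infty;H)$, put $N_*=N_*(|f|_\infty,\nu)$. Then for every $N\ge N_*$, every $\mu\in[\mu_*(N_*),\mu_*(N)]$, all $v_0,u_0\in V$, and every strong solution $(v,u)$ of the system above, $$|v(t)-u(t)|\to0\quad\text{as }t\to\infty.$$ -/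

import Mathlib

open MeasureTheory Filter Topology

noncomputable section

namespace NSE2D

instance factTwoPiPos : Fact (0 < 2 * Real.pi) := ⟨Real.two_pi_pos⟩

/-- The periodic box `Ω = (ℝ / 2πℤ)²`; its `volume` is Lebesgue measure, of total mass `(2π)²`. -/
abbrev Torus : Type := Fin 2 → AddCircle (2 * Real.pi)

/-- Square integrable, real valued, `2π`-periodic vector fields. The norm is
`(∫_Ω |u(x)|² dx)^(1/2)`. -/
abbrev VField : Type := Lp (EuclideanSpace ℝ (Fin 2)) 2 (volume : Measure Torus)

/-- The character `x ↦ exp (i k · x)`. -/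
def expMode (k : Fin 2 → ℤ) : C(Torus, ℂ) where
  toFun x := ∏ i, fourier (k i) (x i)
  continuous_toFun := by fun_prop

/-- The `i`-th component of the Fourier coefficient
`û_k = (2π)⁻² ∫_Ω u(x) exp (-i k · x) dx`. -/
def coeff (u : VField) (k : Fin 2 → ℤ) (i : Fin 2) : ℂ :=
  (((2 * Real.pi) ^ 2 : ℝ) : ℂ)⁻¹ *
    ∫ x, (starRingEnd ℂ) (expMode k x) * ((u x i : ℝ) : ℂ)

/-- The length `|k| = (k₁² + k₂²)^(1/2)` of a wavenumber. -/
def waveLen (k : Fin 2 → ℤ) : ℝ := Real.sqrt (∑ i, (k i : ℝ) ^ 2)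

theorem memLp_expMode (k : Fin 2 → ℤ) : MemLp (expMode k) 2 (volume : Measure Torus) :=
  (BoundedContinuousFunction.mkOfCompact (expMode k)).memLp_top.mono_exponent le_top

/-- Auxiliary: the Fourier coefficients as continuous linear functionals. -/
def coeffL (k : Fin 2 → ℤ) (i : Fin 2) : VField →L[ℝ] ℂ :=
  ((((2 * Real.pi) ^ 2 : ℝ) : ℂ)⁻¹ •
    (innerSL ℂ ((memLp_expMode k).toLp (expMode k))).restrictScalars ℝ) ∘L
    (Complex.ofRealCLM ∘L
      (EuclideanSpace.proj i : EuclideanSpace ℝ (Fin 2) →L[ℝ] ℝ)).compLpL 2 volume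

theorem coeffL_apply (k : Fin 2 → ℤ) (i : Fin 2) (u : VField) : coeffL k i u = coeff u k i := by
  unfold coeffL coeff
  simp only [ContinuousLinearMap.comp_apply, smul_apply,
    ContinuousLinearMap.coe_restrictScalars', innerSL_apply_apply, smul_eq_mul, L2.inner_def]
  congr 1
  refine integral_congr_ae ?_
  filter_upwards [(memLp_expMode k).coeFn_toLp,
    ContinuousLinearMap.coeFn_compLpL (p := 2) (μ := (volume : Measure Torus))
      (Complex.ofRealCLM ∘L (EuclideanSpace.proj i : EuclideanSpace ℝ (Fin 2) →L[ℝ] ℝ)) u]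
    with x h1 h2
  rw [h1, h2]
  simp [mul_comm]

/-- The closed subspace of mean-free, divergence-free fields. -/
def solenoidal : Submodule ℝ VField :=
  (⨅ i, (coeffL 0 i).ker) ⊓ ⨅ k : Fin 2 → ℤ, (∑ i, (k i : ℝ) • coeffL k i).ker

/-- Membership in `solenoidal`: `û_0 = 0` (mean-free) and `k · û_k = 0` for all `k`
(divergence-free in the sense of distributions). -/
theorem mem_solenoidal {u : VField} :
    u ∈ solenoidal ↔ (∀ i, coeff u 0 i = 0) ∧ ∀ k, ∑ i, (k i : ℂ) * coeff u k i = 0 := by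
  simp [solenoidal, Submodule.mem_iInf, coeffL_apply, LinearMap.mem_ker]

instance completeSolenoidal : CompleteSpace solenoidal := by
  refine IsClosed.completeSpace_coe (hs := ?_)
  simp only [solenoidal, Submodule.coe_inf, Submodule.coe_iInf]
  exact (isClosed_iInter fun i => (coeffL 0 i).isClosed_ker).inter
    (isClosed_iInter fun k => ContinuousLinearMap.isClosed_ker _)

/-- The Hilbert space `H` of square integrable, mean-free, divergence-free periodic fields,
with the `L²` inner product. -/
abbrev H : Type := solenoidal

/-- The Leray projection: the orthogonal projection of `L²` onto `H`. -/
def leray : VField →L[ℝ] H := solenoidal.orthogonalProjectionOnto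

/-- The fields in `H` supported on the wavenumbers `|k| ≤ N`. -/
def lowModes (N : ℝ) : Submodule ℝ H :=
  ⨅ k : {k : Fin 2 → ℤ // N < waveLen k}, ⨅ i, (coeffL k.1 i ∘L solenoidal.subtypeL).ker

theorem mem_lowModes {N : ℝ} {u : H} :
    u ∈ lowModes N ↔ ∀ k, N < waveLen k → ∀ i, coeff (u : VField) k i = 0 := by
  simp [lowModes, Submodule.mem_iInf, coeffL_apply, LinearMap.mem_ker]

instance completeLowModes (N : ℝ) : CompleteSpace (lowModes N) := by
  refine IsClosed.completeSpace_coe (hs := ?_)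
  simp only [lowModes, Submodule.coe_iInf]
  exact isClosed_iInter fun k => isClosed_iInter fun i => ContinuousLinearMap.isClosed_ker _

/-- The projection `P_N` of `H` onto the wavenumbers `|k| ≤ N`. -/
def lowProj (N : ℝ) : H →L[ℝ] H := (lowModes N).starProjection

/-- `g = ∂_j u` in the sense of distributions, both being square integrable. -/
def IsPartial (j : Fin 2) (u g : VField) : Prop :=
  ∀ k i, coeff g k i = Complex.I * (k j : ℂ) * coeff u k i

/-- `u` belongs to `V`: its first weak derivatives are square integrable. -/
def MemV (u : H) : Prop :=
  ∃ g : Fin 2 → VField, ∀ j, IsPartial j (u : VField) (g j)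

/-- The curve `u` belongs to `C([0,∞); V)`, where `V` carries the norm
`‖u‖² = ∑ j, |∂_j u|²` (equivalent to the full norm of `H¹` on mean-free fields). -/
def ContinuousInV (u : ℝ → H) : Prop :=
  ContinuousOn u (Set.Ici 0) ∧
    ∃ g : Fin 2 → ℝ → VField, ∀ j, ContinuousOn (g j) (Set.Ici 0) ∧
      ∀ t, 0 ≤ t → IsPartial j (u t : VField) (g j t)

/-- `u ∈ D(A)` and `a = A u`, with `A = -ℙ Δ` the Stokes operator, which multiplies the
`k`-th Fourier coefficient by `|k|²`. -/
def IsStokes (u a : H) : Prop :=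
  ∀ k i, coeff (a : VField) k i = ((waveLen k ^ 2 : ℝ) : ℂ) * coeff (u : VField) k i

/-- `b = B(u,v) = ℙ ((u · ∇) v)`, where `(u · ∇) v = ∑ j, u_j ∂_j v` is square integrable. -/
def IsConvection (u v b : H) : Prop :=
  ∃ g : Fin 2 → VField, (∀ j, IsPartial j (v : VField) (g j)) ∧
    ∃ y : VField, (y =ᵐ[volume] fun x => ∑ j, (u : VField) x j • (g j) x) ∧ b = leray y

/-- `F ∈ L²(0,T; H)` for every `T > 0`. -/
def LocallySqIntegrable (F : ℝ → H) : Prop :=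
  ∀ T : ℝ, 0 < T → MemLp F 2 (volume.restrict (Set.Ioo 0 T))

/-- `u` is a (global) strong solution of `du/dt + ν A u + B(u,u) = F`, `u(0) = u₀`: for every
`T > 0`, `u ∈ C([0,T]; V) ∩ L²(0,T; D(A))` and `du/dt ∈ L²(0,T; H)`, and the equation holds in
`H` for almost every `t > 0`. Here `u'`, `a` and `b` stand for `du/dt`, `A u` and `B(u,u)`. -/
structure IsStrongSolution (ν : ℝ) (F : ℝ → H) (u₀ : H) (u : ℝ → H) : Prop where
  init : u 0 = u₀
  continuousInV : ContinuousInV u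
  equation : ∃ u' a b : ℝ → H,
    LocallySqIntegrable u' ∧ LocallySqIntegrable a ∧
    (∀ t, 0 ≤ t → u t = u 0 + ∫ s in (0 : ℝ)..t, u' s) ∧
    ∀ᵐ t ∂(volume.restrict (Set.Ioi (0 : ℝ))),
      IsStokes (u t) (a t) ∧ IsConvection (u t) (u t) (b t) ∧
        u' t + ν • a t + b t = F t

/-- `(v,u)` is a strong solution of the nudging system
`dv/dt + ν A v + B(v,v) = f - μ P_N v + μ P_N u`, `v(0) = v₀`,
`du/dt + ν A u + B(u,u) = f`, `u(0) = u₀`. -/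
structure IsNudgingSolution (ν μ N : ℝ) (f : ℝ → H) (v₀ u₀ : H) (v u : ℝ → H) : Prop where
  nudged : IsStrongSolution ν (fun t => f t - μ • lowProj N (v t) + μ • lowProj N (u t)) v₀ v
  reference : IsStrongSolution ν f u₀ u

/-- `f ∈ L^∞(0,∞; H)`. -/
def EssBounded (f : ℝ → H) : Prop := MemLp f ⊤ (volume.restrict (Set.Ioi (0 : ℝ)))

/-- The (essential) supremum of `|f(t)|` over `t > 0`. -/
def supNorm (f : ℝ → H) : ℝ := (eLpNorm f ⊤ (volume.restrict (Set.Ioi (0 : ℝ)))).toReal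

end NSE2D

end

noncomputable section

namespace NSE2D

/-! Put `w = v - u` and test the difference of the two equations with `w`. The nudging contributes
`-2μ|P_N w|²` and the viscosity `-2ν‖w‖²`. Since `∫ ((v · ∇) w) · w = 0`, the only surviving
nonlinear term is `∫ ((w · ∇) u) · w`, which the two-dimensional Ladyzhenskaya inequality bounds by
`40 |w| ‖w‖ ‖u‖`. Young's inequality spends one copy of `ν‖w‖²` on it; the other copy controls the
high modes, as `N²|w - P_N w|² ≤ ‖w‖²`. Hence `d/dt |w|² ≤ (-min(νN², 2μ) + (1600/ν)‖u‖²) |w|²`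
(`two_mul_inner_le_of_nudging`).

The energy inequality for `u` gives `ν ∫₀ᵗ ‖u‖² ≤ |u(0)|² + t|f|²_∞/ν`, so Grönwall yields
exponential decay as soon as `min(νN², 2μ) > 1600|f|²_∞/ν³` (`IsNudgingSolution.tendsto_norm_sub`).
Only the time average of `‖u‖²` matters; no pointwise bound on the enstrophy is needed.

The analysis is done on Fourier coefficients: Parseval and the convolution formula replace
integration by parts, and Ladyzhenskaya's inequality follows from a weighted convolution estimate
(`tsum_convolution_sq_le`). Membership in `D(A)` for almost every time makes the fields bounded, so
every product that occurs is integrable. -/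

/-! ### Characters of the torus and completeness of the Fourier system -/

lemma expMode_neg (n : Fin 2 → ℤ) (x : Torus) :
    expMode (-n) x = (starRingEnd ℂ) (expMode n x) := by
  simp only [expMode, Pi.neg_apply, fourier_neg, ContinuousMap.coe_mk, map_prod]

lemma expMode_add (m n : Fin 2 → ℤ) (x : Torus) :
    expMode (m + n) x = expMode m x * expMode n x := by
  simp only [expMode, Pi.add_apply, fourier_add, ContinuousMap.coe_mk, ← Finset.prod_mul_distrib]

lemma expMode_zero (x : Torus) : expMode 0 x = 1 := by
  simp [expMode]

lemma norm_expMode_apply (n : Fin 2 → ℤ) (x : Torus) : ‖expMode n x‖ = 1 := by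
  have h : ∀ i, ‖fourier (n i) (x i)‖ = 1 := fun i => by rw [fourier_apply, Circle.norm_coe]
  simp only [expMode, ContinuousMap.coe_mk, norm_prod, h, Finset.prod_const_one]

lemma norm_expMode_le (n : Fin 2 → ℤ) : ‖expMode n‖ ≤ 1 :=
  (ContinuousMap.norm_le _ zero_le_one).mpr fun x => (norm_expMode_apply n x).le

lemma expMode_single (x : Torus) (i : Fin 2) : expMode (Pi.single i 1) x = fourier 1 (x i) := by
  fin_cases i <;> simp [expMode]

/-- The star algebra of trigonometric polynomials. -/
def trigAlgebra : StarSubalgebra ℂ C(Torus, ℂ) where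
  toSubalgebra := Algebra.adjoin ℂ (Set.range expMode)
  star_mem' := by
    change Algebra.adjoin ℂ (Set.range expMode) ≤ star (Algebra.adjoin ℂ (Set.range expMode))
    refine Algebra.adjoin_le ?_
    rintro _ ⟨n, rfl⟩
    refine Algebra.subset_adjoin ⟨-n, ?_⟩
    ext1 x
    simp only [expMode_neg, starRingEnd_apply, ContinuousMap.star_apply]

lemma trigAlgebra_coe :
    trigAlgebra.toSubalgebra.toSubmodule = Submodule.span ℂ (Set.range expMode) := by
  apply Algebra.adjoin_eq_span_of_subset
  refine .trans (fun x ↦ Submonoid.closure_induction (fun _ ↦ id) ⟨0, ?_⟩ ?_) Submodule.subset_span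
  · ext z
    simp [expMode_zero]
  · rintro _ _ _ _ ⟨m, rfl⟩ ⟨n, rfl⟩
    refine ⟨m + n, ?_⟩
    ext z
    simp [expMode_add]

/-- Points that differ in coordinate `i` are separated by the character of the `i`-th unit
wavenumber, because the circle map is injective on one period. -/
lemma trigAlgebra_separatesPoints : trigAlgebra.SeparatesPoints := by
  intro x y hxy
  rw [Ne, funext_iff, not_forall] at hxy
  obtain ⟨i, hi⟩ := hxy
  refine ⟨_, ⟨expMode (Pi.single i 1), Algebra.subset_adjoin ⟨Pi.single i 1, rfl⟩, rfl⟩, ?_⟩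
  dsimp only
  rw [expMode_single, expMode_single, fourier_one, fourier_one]
  exact fun h => hi (AddCircle.injective_toCircle Real.two_pi_pos.ne' (Circle.ext h))

lemma span_expMode_closure_eq_top :
    (Submodule.span ℂ (Set.range expMode)).topologicalClosure = ⊤ := by
  rw [← trigAlgebra_coe]
  exact congr_arg (Subalgebra.toSubmodule <| StarSubalgebra.toSubalgebra ·)
    (ContinuousMap.starSubalgebra_topologicalClosure_eq_top_of_separatesPoints _
      trigAlgebra_separatesPoints)

/-- The characters as elements of `L²`. -/
abbrev expModeLp (k : Fin 2 → ℤ) : Lp ℂ 2 (volume : Measure Torus) :=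
  ContinuousMap.toLp (E := ℂ) 2 volume ℂ (expMode k)

lemma span_expModeLp_closure_eq_top :
    (Submodule.span ℂ (Set.range expModeLp)).topologicalClosure = ⊤ := by
  simpa only [Submodule.map_span, ContinuousLinearMap.coe_coe, ← Set.range_comp,
    Function.comp_def] using
    (ContinuousMap.toLp_denseRange ℂ volume ℂ (by simp)).topologicalClosure_map_submodule
      span_expMode_closure_eq_top

lemma integral_fourier (n : ℤ) :
    ∫ x : AddCircle (2 * Real.pi), fourier n x = if n = 0 then ((2 * Real.pi : ℝ) : ℂ) else 0 := by
  rw [AddCircle.volume_eq_smul_haarAddCircle, integral_smul_measure]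
  have h := (orthonormal_iff_ite.mp (orthonormal_fourier (T := 2 * Real.pi))) 0 n
  rw [ContinuousMap.inner_toLp] at h
  simp only [fourier_zero, map_one, mul_one] at h
  rw [h, ENNReal.toReal_ofReal Real.two_pi_pos.le]
  by_cases hn : n = 0
  · simp [hn]
  · simp [hn, Ne.symm hn]

lemma integral_expMode (k : Fin 2 → ℤ) :
    ∫ x, expMode k x = if k = 0 then (((2 * Real.pi) ^ 2 : ℝ) : ℂ) else 0 := by
  simp only [expMode, ContinuousMap.coe_mk]
  rw [MeasureTheory.integral_fintype_prod_volume_eq_prod]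
  simp only [integral_fourier]
  split_ifs with h
  · simp [h]
  · obtain ⟨i, hi⟩ := Function.ne_iff.mp h
    exact Finset.prod_eq_zero (Finset.mem_univ i) (if_neg hi)

lemma inner_expModeLp (k l : Fin 2 → ℤ) :
    inner ℂ (expModeLp k) (expModeLp l)
      = if k = l then (((2 * Real.pi) ^ 2 : ℝ) : ℂ) else 0 := by
  rw [ContinuousMap.inner_toLp]
  simp only [← expMode_neg, ← expMode_add]
  rw [integral_expMode]
  simp [add_neg_eq_zero, eq_comm]

lemma orthonormal_expModeLp :
    Orthonormal ℂ fun k => (((2 * Real.pi)⁻¹ : ℝ) : ℂ) • expModeLp k := by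
  rw [orthonormal_iff_ite]
  intro k l
  rw [inner_smul_left, inner_smul_right, inner_expModeLp, Complex.conj_ofReal]
  split_ifs
  · rw [← Complex.ofReal_mul, ← Complex.ofReal_mul]
    have := Real.pi_pos
    rw [Complex.ofReal_eq_one]
    field_simp
  · simp

/-- The orthonormal Fourier basis of `L²(Ω; ℂ)`. -/
def torusBasis : HilbertBasis (Fin 2 → ℤ) ℂ (Lp ℂ 2 (volume : Measure Torus)) :=
  HilbertBasis.mk orthonormal_expModeLp (by
    rw [← span_expModeLp_closure_eq_top]
    refine Submodule.topologicalClosure_mono (Submodule.span_le.mpr ?_)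
    rintro _ ⟨k, rfl⟩
    have h : expModeLp k = ((2 * Real.pi : ℝ) : ℂ) •
        ((((2 * Real.pi)⁻¹ : ℝ) : ℂ) • expModeLp k) := by
      rw [smul_smul, ← Complex.ofReal_mul, mul_inv_cancel₀ Real.two_pi_pos.ne', Complex.ofReal_one,
        one_smul]
    rw [h]
    exact Submodule.smul_mem _ _ (Submodule.subset_span ⟨k, rfl⟩))

lemma torusBasis_apply (k : Fin 2 → ℤ) :
    torusBasis k = (((2 * Real.pi)⁻¹ : ℝ) : ℂ) • expModeLp k := by
  simp [torusBasis]

/-! ### Parseval, convolution and absolutely convergent Fourier series -/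

/-- The Fourier coefficients of a scalar function. -/
def fcoeff (f : Torus → ℂ) (k : Fin 2 → ℤ) : ℂ :=
  (((2 * Real.pi) ^ 2 : ℝ) : ℂ)⁻¹ * ∫ x, (starRingEnd ℂ) (expMode k x) * f x

lemma fcoeff_congr {f g : Torus → ℂ} (h : f =ᵐ[volume] g) (k : Fin 2 → ℤ) :
    fcoeff f k = fcoeff g k := by
  unfold fcoeff
  congr 1
  exact integral_congr_ae (h.mono fun x hx => by simp only [hx])

lemma inner_expModeLp_toLp {f : Torus → ℂ} (hf : MemLp f 2 volume) (k : Fin 2 → ℤ) :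
    inner ℂ (expModeLp k) (hf.toLp f) = (((2 * Real.pi) ^ 2 : ℝ) : ℂ) * fcoeff f k := by
  have h0 : (((2 * Real.pi) ^ 2 : ℝ) : ℂ) ≠ 0 := by
    exact_mod_cast (pow_pos Real.two_pi_pos 2).ne'
  rw [fcoeff, mul_inv_cancel_left₀ h0, L2.inner_def]
  refine integral_congr_ae ?_
  filter_upwards [hf.coeFn_toLp, ContinuousMap.coeFn_toLp (p := 2) (𝕜 := ℂ) volume (expMode k)]
    with x h1 h2
  rw [h1, h2]
  simp [mul_comm]

/-- The Parseval identity. -/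
lemma hasSum_conj_fcoeff_mul {f g : Torus → ℂ} (hf : MemLp f 2 volume) (hg : MemLp g 2 volume) :
    HasSum (fun k => (starRingEnd ℂ) (fcoeff f k) * fcoeff g k)
      ((((2 * Real.pi) ^ 2 : ℝ) : ℂ)⁻¹ * ∫ x, (starRingEnd ℂ) (f x) * g x) := by
  have h0 : (((2 * Real.pi) : ℝ) : ℂ) ≠ 0 := by
    exact_mod_cast Real.two_pi_pos.ne'
  have h := (torusBasis.hasSum_inner_mul_inner (hf.toLp f) (hg.toLp g)).mul_left
    ((((2 * Real.pi) ^ 2 : ℝ) : ℂ)⁻¹)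
  convert! h using 1
  · ext k
    rw [torusBasis_apply, inner_smul_left, inner_smul_right, inner_expModeLp_toLp,
      ← inner_conj_symm, inner_expModeLp_toLp]
    simp only [map_mul, Complex.conj_ofReal]
    push_cast at h0 ⊢
    field_simp
  · congr 1
    rw [L2.inner_def]
    refine integral_congr_ae ?_
    filter_upwards [hf.coeFn_toLp, hg.coeFn_toLp] with x h1 h2
    rw [h1, h2]
    simp [mul_comm]

lemma hasSum_norm_fcoeff_sq {f : Torus → ℂ} (hf : MemLp f 2 volume) :
    HasSum (fun k => ‖fcoeff f k‖ ^ 2) (((2 * Real.pi) ^ 2)⁻¹ * ∫ x, ‖f x‖ ^ 2) := by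
  rw [← Complex.hasSum_ofReal]
  convert! hasSum_conj_fcoeff_mul hf hf using 1
  · ext k
    rw [Complex.conj_mul', Complex.ofReal_pow]
  · rw [Complex.ofReal_mul, Complex.ofReal_inv]
    congr 1
    rw [← integral_complex_ofReal]
    congr 1
    ext x
    rw [Complex.conj_mul', Complex.ofReal_pow]

/-- The Fourier coefficients of a product are the convolution of the Fourier coefficients. -/
lemma hasSum_fcoeff_mul {f g : Torus → ℂ} (hf : MemLp f 2 volume) (hg : MemLp g 2 volume)
    (n : Fin 2 → ℤ) :
    HasSum (fun k => fcoeff f (n - k) * fcoeff g k) (fcoeff (fun x => f x * g x) n) := by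
  -- The convolution formula is Parseval applied to the pair `conj f · e_n` and `g`; conjugation
  -- turns the coefficient at `k` into that of `f` at `n - k`.
  have hF : MemLp (fun x => (starRingEnd ℂ) (f x) * expMode n x) 2 volume := by
    have h1 : AEStronglyMeasurable (fun x => (starRingEnd ℂ) (f x) * expMode n x)
        (volume : Measure Torus) :=
      (Complex.continuous_conj.comp_aestronglyMeasurable hf.1).mul
        (expMode n).continuous.aestronglyMeasurable
    refine hf.of_le h1 (Eventually.of_forall fun x => ?_)
    simp [norm_expMode_apply]
  have hc : ∀ k, fcoeff (fun x => (starRingEnd ℂ) (f x) * expMode n x) k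
      = (starRingEnd ℂ) (fcoeff f (n - k)) := by
    intro k
    unfold fcoeff
    rw [map_mul, ← integral_conj, map_inv₀, Complex.conj_ofReal]
    congr 2
    ext x
    rw [sub_eq_add_neg, expMode_add, expMode_neg]
    simp only [map_mul, Complex.conj_conj]
    ring
  have h := hasSum_conj_fcoeff_mul hF hg
  simp only [hc, Complex.conj_conj, map_mul] at h
  convert! h using 1
  unfold fcoeff
  congr 2
  ext x
  ring

/-- A square integrable function with summable Fourier coefficients is essentially bounded. -/
lemma exists_bound_of_summable_fcoeff {f : Torus → ℂ} (hf : MemLp f 2 volume)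
    (hs : Summable fun k => ‖fcoeff f k‖) : ∃ C : ℝ, ∀ᵐ x ∂(volume : Measure Torus), ‖f x‖ ≤ C := by
  have hs' : Summable fun k => fcoeff f k • expMode k := by
    refine Summable.of_norm_bounded hs fun k => ?_
    rw [norm_smul]
    exact mul_le_of_le_one_right (norm_nonneg _) (norm_expMode_le k)
  set F : C(Torus, ℂ) := ∑' k, fcoeff f k • expMode k with hF
  have h1 := (hs'.hasSum).mapL (ContinuousMap.toLp (E := ℂ) 2 (volume : Measure Torus) ℂ)
  have h2 := torusBasis.hasSum_repr (hf.toLp f)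
  -- The uniformly convergent series and the `L²` expansion of `f` have the same terms, so their
  -- limits agree in `L²`.
  have h3 : ContinuousMap.toLp (E := ℂ) 2 (volume : Measure Torus) ℂ F = hf.toLp f := by
    refine h1.unique ?_
    convert! h2 using 2 with k
    rw [torusBasis.repr_apply_apply, torusBasis_apply, inner_smul_left, inner_expModeLp_toLp,
      map_smul, smul_smul]
    congr 1
    have h0 : (((2 * Real.pi) : ℝ) : ℂ) ≠ 0 := by
      exact_mod_cast Real.two_pi_pos.ne'
    rw [Complex.conj_ofReal]
    push_cast at h0 ⊢
    field_simp
  refine ⟨‖F‖, ?_⟩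
  have h4 := ContinuousMap.coeFn_toLp (p := 2) (𝕜 := ℂ) (volume : Measure Torus) F
  rw [h3] at h4
  filter_upwards [h4, hf.coeFn_toLp] with x h5 h6
  rw [← h6, h5]
  exact F.norm_coe_le_norm x

/-! ### Energy and Grönwall inequalities for absolutely continuous curves -/

lemma absolutelyContinuousOnInterval_of_dist_le {X Y : Type*} [PseudoMetricSpace X]
    [PseudoMetricSpace Y] {f : ℝ → X} {g : ℝ → Y} {a b : ℝ}
    (hg : AbsolutelyContinuousOnInterval g a b)
    (h : ∀ x ∈ Set.uIcc a b, ∀ y ∈ Set.uIcc a b, dist (f x) (f y) ≤ dist (g x) (g y)) :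
    AbsolutelyContinuousOnInterval f a b := by
  rw [absolutelyContinuousOnInterval_iff] at hg ⊢
  intro ε hε
  obtain ⟨δ, hδ, H⟩ := hg ε hε
  refine ⟨δ, hδ, fun E hE hlen => lt_of_le_of_lt (Finset.sum_le_sum fun i hi => ?_) (H E hE hlen)⟩
  exact h _ (hE.1 i hi).1 _ (hE.1 i hi).2

/-- Absolute continuity lets the increment be recovered from the derivative, which is known only
almost everywhere; continuity alone would not do. -/
lemma le_of_ae_hasDerivAt_nonpos {h h' : ℝ → ℝ} {T : ℝ} (hT : 0 ≤ T)
    (hh : AbsolutelyContinuousOnInterval h 0 T)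
    (hd : ∀ᵐ t, t ∈ Set.Ioo 0 T → HasDerivAt h (h' t) t ∧ h' t ≤ 0) : h T ≤ h 0 := by
  have h1 := hh.integral_deriv_eq_sub
  have h2 : ∫ x in (0 : ℝ)..T, deriv h x ≤ 0 := by
    rw [intervalIntegral.integral_of_le hT, integral_Ioc_eq_integral_Ioo]
    refine integral_nonpos_of_ae ?_
    rw [EventuallyLE, ae_restrict_iff' measurableSet_Ioo]
    filter_upwards [hd] with t ht htT
    obtain ⟨h3, h4⟩ := ht htT
    rw [h3.deriv]
    exact h4
  linarith

section Energy

variable {E : Type*} [NormedAddCommGroup E] [InnerProductSpace ℝ E]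
  {w w' : ℝ → E}

/-- Increments of `‖w‖` are dominated by those of `∫ ‖w'‖`, and products of absolutely continuous
functions are absolutely continuous. -/
lemma absolutelyContinuousOnInterval_norm_sq {T : ℝ} (hT : 0 ≤ T)
    (hi : IntervalIntegrable w' volume 0 T)
    (hw : ∀ t, 0 ≤ t → w t = w 0 + ∫ s in (0 : ℝ)..t, w' s) :
    AbsolutelyContinuousOnInterval (fun t => ‖w t‖ ^ 2) 0 T := by
  have hG := hi.norm.absolutelyContinuousOnInterval_intervalIntegral (c := 0) (by simp)
  have hsub : ∀ x ∈ Set.uIcc 0 T, IntervalIntegrable w' volume 0 x := fun x hx =>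
    hi.mono_set (Set.uIcc_subset_uIcc Set.left_mem_uIcc hx)
  have hn : AbsolutelyContinuousOnInterval (fun t => ‖w t‖) 0 T := by
    refine absolutelyContinuousOnInterval_of_dist_le hG fun x hx y hy => ?_
    have hx0 : 0 ≤ x := by rw [Set.uIcc_of_le hT] at hx; exact hx.1
    have hy0 : 0 ≤ y := by rw [Set.uIcc_of_le hT] at hy; exact hy.1
    rw [dist_eq_norm, dist_eq_norm, intervalIntegral.integral_interval_sub_left
      (hsub x hx).norm (hsub y hy).norm, Real.norm_eq_abs, Real.norm_eq_abs]
    refine (abs_norm_sub_norm_le _ _).trans ?_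
    rw [hw x hx0, hw y hy0, add_sub_add_left_eq_sub,
      intervalIntegral.integral_interval_sub_left (hsub x hx) (hsub y hy)]
    exact intervalIntegral.norm_integral_le_abs_integral_norm
  simpa only [pow_two] using hn.fun_mul hn

lemma ae_hasDerivAt_norm_sq [CompleteSpace E] {T : ℝ} (hT : 0 ≤ T)
    (hi : IntervalIntegrable w' volume 0 T)
    (hw : ∀ t, 0 ≤ t → w t = w 0 + ∫ s in (0 : ℝ)..t, w' s) :
    ∀ᵐ t, t ∈ Set.Ioo 0 T → HasDerivAt (fun t => ‖w t‖ ^ 2) (2 * inner ℝ (w t) (w' t)) t := by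
  filter_upwards [hi.ae_hasDerivAt_integral] with t ht htT
  have h1 := (ht (by rw [Set.uIcc_of_le hT]; exact ⟨htT.1.le, htT.2.le⟩) 0
    Set.left_mem_uIcc).const_add (w 0)
  have h2 : HasDerivAt w (w' t) t := by
    refine h1.congr_of_eventuallyEq ?_
    filter_upwards [Ioi_mem_nhds htT.1] with s hs
    exact hw s (le_of_lt hs)
  exact h2.norm_sq

/-- The energy inequality in integrated form. -/
lemma norm_sq_le_of_inner_le [CompleteSpace E] {β : ℝ → ℝ} (hβ : Continuous β)
    (hi : ∀ T, 0 < T → IntervalIntegrable w' volume 0 T)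
    (hw : ∀ t, 0 ≤ t → w t = w 0 + ∫ s in (0 : ℝ)..t, w' s)
    (hle : ∀ᵐ t ∂(volume.restrict (Set.Ioi (0 : ℝ))), 2 * inner ℝ (w t) (w' t) ≤ β t)
    {T : ℝ} (hT : 0 < T) : ‖w T‖ ^ 2 ≤ ‖w 0‖ ^ 2 + ∫ s in (0 : ℝ)..T, β s := by
  have hB := fun t => hβ.integral_hasStrictDerivAt 0 t
  have hBac : AbsolutelyContinuousOnInterval (fun t => ∫ s in (0 : ℝ)..t, β s) 0 T :=
    (hβ.intervalIntegrable 0 T).absolutelyContinuousOnInterval_intervalIntegral (by simp)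
  have h := le_of_ae_hasDerivAt_nonpos (h' := fun t => 2 * inner ℝ (w t) (w' t) - β t) hT.le
    ((absolutelyContinuousOnInterval_norm_sq hT.le (hi T hT) hw).fun_sub hBac) (by
      rw [ae_restrict_iff' measurableSet_Ioi] at hle
      filter_upwards [hle, ae_hasDerivAt_norm_sq hT.le (hi T hT) hw] with t h1 h2 ht
      exact ⟨(h2 ht).sub (hB t).hasDerivAt, sub_nonpos.mpr (h1 ht.1)⟩)
  simp only [intervalIntegral.integral_same, sub_zero] at h
  linarith

/-- The Grönwall inequality for the squared norm of an absolutely continuous curve. -/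
lemma norm_sq_le_exp_of_inner_le [CompleteSpace E] {α : ℝ → ℝ} (hα : Continuous α)
    (hi : ∀ T, 0 < T → IntervalIntegrable w' volume 0 T)
    (hw : ∀ t, 0 ≤ t → w t = w 0 + ∫ s in (0 : ℝ)..t, w' s)
    (hle : ∀ᵐ t ∂(volume.restrict (Set.Ioi (0 : ℝ))),
      2 * inner ℝ (w t) (w' t) ≤ α t * ‖w t‖ ^ 2)
    {T : ℝ} (hT : 0 < T) : ‖w T‖ ^ 2 ≤ ‖w 0‖ ^ 2 * Real.exp (∫ s in (0 : ℝ)..T, α s) := by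
  have hA := fun t => (hα.integral_hasStrictDerivAt 0 t).hasDerivAt
  have hE : ∀ t, HasDerivAt (fun t => Real.exp (-∫ s in (0 : ℝ)..t, α s))
      (Real.exp (-∫ s in (0 : ℝ)..t, α s) * -α t) t := fun t => (hA t).neg.exp
  -- The integrating factor `exp(-∫ α)` is C¹ because `α` is continuous; its product with `‖w‖²` is
  -- then nonincreasing.
  have hEac : AbsolutelyContinuousOnInterval
      (fun t => Real.exp (-∫ s in (0 : ℝ)..t, α s)) 0 T := by
    refine ContDiffOn.absolutelyContinuousOnInterval (ContDiff.contDiffOn ?_)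
    rw [contDiff_one_iff_deriv]
    refine ⟨fun t => (hE t).differentiableAt, ?_⟩
    rw [show deriv (fun t => Real.exp (-∫ s in (0 : ℝ)..t, α s)) = _ from
      funext fun t => (hE t).deriv]
    have hc : Continuous fun t => ∫ s in (0 : ℝ)..t, α s :=
      continuous_iff_continuousAt.mpr fun t => (hA t).continuousAt
    fun_prop
  have h := le_of_ae_hasDerivAt_nonpos
    (h' := fun t => 2 * inner ℝ (w t) (w' t) * Real.exp (-∫ s in (0 : ℝ)..t, α s)
      + ‖w t‖ ^ 2 * (Real.exp (-∫ s in (0 : ℝ)..t, α s) * -α t)) hT.le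
    ((absolutelyContinuousOnInterval_norm_sq hT.le (hi T hT) hw).fun_mul hEac) (by
      rw [ae_restrict_iff' measurableSet_Ioi] at hle
      filter_upwards [hle, ae_hasDerivAt_norm_sq hT.le (hi T hT) hw] with t h1 h2 ht
      refine ⟨(h2 ht).mul (hE t), ?_⟩
      have h3 := mul_nonneg (sub_nonneg.mpr (h1 ht.1))
        (Real.exp_pos (-∫ s in (0 : ℝ)..t, α s)).le
      linarith)
  simp only [intervalIntegral.integral_same, neg_zero, Real.exp_zero, mul_one] at h
  have h4 := mul_le_mul_of_nonneg_right h (Real.exp_pos (∫ s in (0 : ℝ)..T, α s)).le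
  rwa [mul_assoc, ← Real.exp_add, neg_add_cancel, Real.exp_zero, mul_one] at h4

end Energy

/-! ### Weighted convolution estimate in two dimensions -/

open scoped ENNReal

/-- Hölder's inequality for counting measure. Extended nonnegative values dispense with summability
conditions and allow free interchange of sums below. -/
lemma ennreal_tsum_mul_sq_le {ι : Type*} (x y : ι → ℝ≥0∞) :
    (∑' k, x k * y k) ^ 2 ≤ (∑' k, x k ^ 2) * ∑' k, y k ^ 2 := by
  let _ : MeasurableSpace ι := ⊤
  have h := ENNReal.lintegral_mul_le_Lp_mul_Lq (Measure.count : Measure ι)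
    Real.HolderConjugate.two_two (f := x) (g := y) (measurable_from_top).aemeasurable
    (measurable_from_top).aemeasurable
  rw [lintegral_count, lintegral_count, lintegral_count, ← ENNReal.mul_rpow_of_nonneg _ _
    (by norm_num : (0 : ℝ) ≤ 1 / 2)] at h
  have h2 := ENNReal.rpow_le_rpow h (by norm_num : (0 : ℝ) ≤ 2)
  rw [← ENNReal.rpow_mul] at h2
  norm_num at h2
  exact h2

/-- Weighted Young type inequality for discrete convolutions. -/
lemma tsum_convolution_sq_le {G : Type*} [AddCommGroup G] {ψ : G → ℝ≥0∞}
    (h0 : ∀ k, ψ k ≠ 0) (htop : ∀ k, ψ k ≠ ⊤) (a b : G → ℝ≥0∞) :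
    ∑' n, (∑' k, a (n - k) * b k) ^ 2 ≤
      (∑' k, (ψ k)⁻¹ ^ 4) * ((∑' k, (ψ k * a k) ^ 2) * ∑' k, (ψ k * b k) ^ 2) := by
  -- Cauchy–Schwarz, together with the invariance of the sum under `k ↦ n - k`, makes the bound
  -- uniform in `n`.
  have hW : ∀ n, ∑' k, ((ψ (n - k))⁻¹ * (ψ k)⁻¹) ^ 2 ≤ ∑' k, (ψ k)⁻¹ ^ 4 := by
    intro n
    have h := ennreal_tsum_mul_sq_le (fun k => (ψ (n - k))⁻¹ ^ 2) fun k => (ψ k)⁻¹ ^ 2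
    simp only [← pow_mul, ← mul_pow] at h
    norm_num only at h
    have he : ∑' k, (ψ (n - k))⁻¹ ^ 4 = ∑' k, (ψ k)⁻¹ ^ 4 :=
      (Equiv.subLeft n).tsum_eq fun k => (ψ k)⁻¹ ^ 4
    rw [he, ← pow_two] at h
    exact (ENNReal.pow_le_pow_left_iff two_ne_zero).mp h
  have hn : ∀ n, (∑' k, a (n - k) * b k) ^ 2 ≤
      (∑' k, (ψ k)⁻¹ ^ 4) * ∑' k, (ψ (n - k) * a (n - k)) ^ 2 * (ψ k * b k) ^ 2 := by
    intro n
    have h := ennreal_tsum_mul_sq_le (fun k => (ψ (n - k))⁻¹ * (ψ k)⁻¹)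
      fun k => (ψ (n - k) * a (n - k)) * (ψ k * b k)
    have he : ∀ k, (ψ (n - k))⁻¹ * (ψ k)⁻¹ * ((ψ (n - k) * a (n - k)) * (ψ k * b k))
        = a (n - k) * b k := by
      intro k
      calc _ = ((ψ (n - k))⁻¹ * ψ (n - k)) * ((ψ k)⁻¹ * ψ k) * (a (n - k) * b k) := by ring
        _ = _ := by
          rw [ENNReal.inv_mul_cancel (h0 _) (htop _), ENNReal.inv_mul_cancel (h0 _) (htop _)]
          ring
    simp only [he] at h
    refine h.trans (mul_le_mul' (hW n) (le_of_eq ?_))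
    simp only [mul_pow]
  refine (ENNReal.tsum_le_tsum hn).trans (le_of_eq ?_)
  rw [ENNReal.tsum_mul_left, ENNReal.tsum_comm]
  congr 1
  have h1 : ∀ k, ∑' n, (ψ (n - k) * a (n - k)) ^ 2 * (ψ k * b k) ^ 2
      = (∑' n, (ψ n * a n) ^ 2) * (ψ k * b k) ^ 2 := by
    intro k
    rw [ENNReal.tsum_mul_right]
    congr 1
    exact (Equiv.subRight k).tsum_eq fun k => (ψ k * a k) ^ 2
  simp only [h1]
  rw [ENNReal.tsum_mul_left]

lemma tsum_nat_inv_one_add_sq_le {R : ℝ} (hR : 1 ≤ R) :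
    ∑' n : ℕ, ENNReal.ofReal (1 + ((n : ℝ) + 1) ^ 2 / R ^ 2)⁻¹ ≤ ENNReal.ofReal (2 * R) := by
  have hR0 : 0 < R := by linarith
  refine ENNReal.tsum_le_of_sum_range_le fun n => ?_
  rw [← ENNReal.ofReal_sum_of_nonneg fun _ _ => by positivity]
  refine ENNReal.ofReal_le_ofReal ?_
  -- The sharper claim telescopes: each term is at most `R² / ((R + n)(R + n + 1) / 2)`, because `(R
  -- + n + 1)² ≤ 2R² + 2(n + 1)²`.
  suffices h : ∑ i ∈ Finset.range n, (1 + ((i : ℝ) + 1) ^ 2 / R ^ 2)⁻¹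
      ≤ 2 * R - 2 * R ^ 2 / (R + n) by
    have : 0 ≤ 2 * R ^ 2 / (R + n) := by positivity
    linarith
  induction n with
  | zero => simp [pow_two, mul_div_assoc]
  | succ n ih =>
    rw [Finset.sum_range_succ]
    have h1 : (1 + ((n : ℝ) + 1) ^ 2 / R ^ 2)⁻¹
        ≤ 2 * R ^ 2 / (R + n) - 2 * R ^ 2 / (R + (n + 1 : ℕ)) := by
      have hn : (0 : ℝ) ≤ n := n.cast_nonneg
      have e1 : (1 + ((n : ℝ) + 1) ^ 2 / R ^ 2)⁻¹ = R ^ 2 / (R ^ 2 + ((n : ℝ) + 1) ^ 2) := by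
        field_simp
      have e2 : 2 * R ^ 2 / (R + n) - 2 * R ^ 2 / (R + (n + 1 : ℕ))
          = R ^ 2 / ((R + n) * (R + n + 1) / 2) := by
        push_cast
        field_simp
        ring
      rw [e1, e2]
      refine div_le_div_of_nonneg_left (by positivity) (by positivity) ?_
      nlinarith [sq_nonneg (R - n - 1)]
    linarith

lemma tsum_int_inv_one_add_sq_le {R : ℝ} (hR : 1 ≤ R) :
    ∑' n : ℤ, ENNReal.ofReal (1 + (n : ℝ) ^ 2 / R ^ 2)⁻¹ ≤ ENNReal.ofReal (5 * R) := by
  have hR0 : 0 < R := by linarith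
  rw [tsum_of_nat_of_neg_add_one ENNReal.summable ENNReal.summable,
    tsum_eq_zero_add' (f := fun n : ℕ => ENNReal.ofReal (1 + (((n : ℤ) : ℝ)) ^ 2 / R ^ 2)⁻¹)
      ENNReal.summable]
  have h1 := tsum_nat_inv_one_add_sq_le hR
  -- The term at zero costs `1 ≤ R`; the positive and the negative integers cost `2R` each.
  have h2 : 5 * R = (R + 2 * R) + 2 * R := by ring
  rw [h2, ENNReal.ofReal_add (by positivity) (by positivity),
    ENNReal.ofReal_add (by positivity) (by positivity)]
  refine add_le_add (add_le_add (ENNReal.ofReal_le_ofReal ?_) ?_) ?_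
  · simpa using hR
  · simpa using h1
  · convert! h1 using 5 with n
    push_cast
    ring

/-- The weight `(1 + |k|² / R²)^(1/2)`. -/
def sobolevWeight (R : ℝ) (k : Fin 2 → ℤ) : ℝ≥0∞ :=
  ENNReal.ofReal (Real.sqrt (1 + waveLen k ^ 2 / R ^ 2))

lemma waveLen_sq (k : Fin 2 → ℤ) : waveLen k ^ 2 = (k 0 : ℝ) ^ 2 + (k 1 : ℝ) ^ 2 := by
  rw [waveLen, Real.sq_sqrt (by positivity), Fin.sum_univ_two]

/-- The inequality `(1 + x + y)² ≥ (1 + x)(1 + y)` for nonnegative `x`, `y` splits the lattice sum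
into two one-dimensional sums. The growth `R²` is what gives Ladyzhenskaya's inequality its
two-dimensional scaling. -/
lemma tsum_sobolevWeight_inv_le {R : ℝ} (hR : 1 ≤ R) :
    ∑' k, (sobolevWeight R k)⁻¹ ^ 4 ≤ ENNReal.ofReal (25 * R ^ 2) := by
  have hR0 : 0 < R := by linarith
  have h1 : ∀ k, (sobolevWeight R k)⁻¹ ^ 4 ≤
      ENNReal.ofReal (1 + (k 0 : ℝ) ^ 2 / R ^ 2)⁻¹ *
        ENNReal.ofReal (1 + (k 1 : ℝ) ^ 2 / R ^ 2)⁻¹ := by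
    intro k
    rw [sobolevWeight, ← ENNReal.ofReal_inv_of_pos (by positivity),
      ← ENNReal.ofReal_pow (by positivity), ← ENNReal.ofReal_mul (by positivity)]
    refine ENNReal.ofReal_le_ofReal ?_
    rw [inv_pow, ← mul_inv, show 4 = 2 * 2 from rfl, pow_mul, Real.sq_sqrt (by positivity),
      waveLen_sq, add_div]
    refine inv_anti₀ (by positivity) ?_
    have : 0 ≤ (k 0 : ℝ) ^ 2 / R ^ 2 := by positivity
    have : 0 ≤ (k 1 : ℝ) ^ 2 / R ^ 2 := by positivity
    nlinarith
  refine (ENNReal.tsum_le_tsum h1).trans ?_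
  rw [← (finTwoArrowEquiv ℤ).symm.tsum_eq]
  simp only [finTwoArrowEquiv_symm_apply, Matrix.cons_val_zero, Matrix.cons_val_one]
  rw [ENNReal.tsum_prod (f := fun m n : ℤ => ENNReal.ofReal (1 + (m : ℝ) ^ 2 / R ^ 2)⁻¹ *
    ENNReal.ofReal (1 + (n : ℝ) ^ 2 / R ^ 2)⁻¹)]
  simp only [ENNReal.tsum_mul_left, ENNReal.tsum_mul_right]
  refine (mul_le_mul' (tsum_int_inv_one_add_sq_le hR) (tsum_int_inv_one_add_sq_le hR)).trans
    (le_of_eq ?_)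
  rw [← ENNReal.ofReal_mul (by positivity)]
  congr 1
  ring

/-- A form of the Ladyzhenskaya inequality, in terms of Fourier coefficients. -/
lemma integral_norm_mul_sq_le {f g : Torus → ℂ} (hf : MemLp f 2 volume) (hg : MemLp g 2 volume)
    (hfg : MemLp (fun x => f x * g x) 2 volume) {R : ℝ} (hR : 1 ≤ R) {A B : ℝ}
    (hA : HasSum (fun k => (1 + waveLen k ^ 2 / R ^ 2) * ‖fcoeff f k‖ ^ 2) A)
    (hB : HasSum (fun k => (1 + waveLen k ^ 2 / R ^ 2) * ‖fcoeff g k‖ ^ 2) B) :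
    ((2 * Real.pi) ^ 2)⁻¹ * ∫ x, ‖f x * g x‖ ^ 2 ≤ 25 * R ^ 2 * (A * B) := by
  have hR0 : 0 < R := by linarith
  have key : ∀ {f : Torus → ℂ} {A : ℝ},
      HasSum (fun k => (1 + waveLen k ^ 2 / R ^ 2) * ‖fcoeff f k‖ ^ 2) A →
      ∑' k, (sobolevWeight R k * ‖fcoeff f k‖ₑ) ^ 2 = ENNReal.ofReal A := by
    intro f A h
    rw [← h.tsum_eq, ENNReal.ofReal_tsum_of_nonneg (fun k => by positivity) h.summable]
    congr 1
    ext1 k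
    rw [sobolevWeight, ← ofReal_norm, ← ENNReal.ofReal_mul (by positivity),
      ← ENNReal.ofReal_pow (by positivity), mul_pow, Real.sq_sqrt (by positivity)]
  have hA0 : 0 ≤ A := hA.nonneg fun k => by positivity
  have hB0 : 0 ≤ B := hB.nonneg fun k => by positivity
  have hP := hasSum_norm_fcoeff_sq hfg
  have h1 : ENNReal.ofReal (((2 * Real.pi) ^ 2)⁻¹ * ∫ x, ‖f x * g x‖ ^ 2) ≤
      ENNReal.ofReal (25 * R ^ 2 * (A * B)) := by
    calc _ = ∑' n, ‖fcoeff (fun x => f x * g x) n‖ₑ ^ 2 := by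
          rw [← hP.tsum_eq, ENNReal.ofReal_tsum_of_nonneg (fun k => by positivity) hP.summable]
          congr 1
          ext1 k
          rw [← ofReal_norm, ← ENNReal.ofReal_pow (by positivity)]
      _ ≤ ∑' n, (∑' k, ‖fcoeff f (n - k)‖ₑ * ‖fcoeff g k‖ₑ) ^ 2 := by
          refine ENNReal.tsum_le_tsum fun n => ?_
          gcongr
          rw [← (hasSum_fcoeff_mul hf hg n).tsum_eq]
          refine (enorm_tsum_le_tsum_enorm).trans (le_of_eq ?_)
          simp only [enorm_mul]
      _ ≤ _ := tsum_convolution_sq_le (ψ := sobolevWeight R)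
          (fun k => by
            rw [sobolevWeight, Ne, ENNReal.ofReal_eq_zero, not_le]
            positivity) (fun k => ENNReal.ofReal_ne_top) (fun k => ‖fcoeff f k‖ₑ)
            fun k => ‖fcoeff g k‖ₑ
      _ ≤ ENNReal.ofReal (25 * R ^ 2) * (ENNReal.ofReal A * ENNReal.ofReal B) := by
          rw [key hA, key hB]
          gcongr
          exact tsum_sobolevWeight_inv_le hR
      _ = _ := by
          rw [← ENNReal.ofReal_mul hA0, ← ENNReal.ofReal_mul (by positivity)]
  exact (ENNReal.ofReal_le_ofReal_iff (by positivity)).mp h1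

/-! ### Vector fields, gradients and the Stokes operator in Fourier variables -/

/-- The components of a vector field, as complex valued functions. -/
def comp (u : VField) (i : Fin 2) (x : Torus) : ℂ := ((u x i : ℝ) : ℂ)

lemma coeff_eq_fcoeff (u : VField) (k : Fin 2 → ℤ) (i : Fin 2) :
    coeff u k i = fcoeff (comp u i) k := rfl

lemma coeff_sub (u v : VField) (k : Fin 2 → ℤ) (i : Fin 2) :
    coeff (u - v) k i = coeff u k i - coeff v k i := by
  simp only [← coeffL_apply, map_sub]

lemma memLp_real_comp (u : VField) (i : Fin 2) :
    MemLp (fun x => u x i) 2 (volume : Measure Torus) :=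
  (EuclideanSpace.proj i : EuclideanSpace ℝ (Fin 2) →L[ℝ] ℝ).comp_memLp' (Lp.memLp u)

lemma memLp_comp (u : VField) (i : Fin 2) : MemLp (comp u i) 2 (volume : Measure Torus) :=
  Complex.ofRealCLM.comp_memLp' (memLp_real_comp u i)

lemma inner_eq_sum_integral (u v : VField) :
    inner ℝ u v = ∑ i, ∫ x, u x i * v x i := by
  rw [L2.inner_def, ← integral_finsetSum]
  · congr 1
    ext x
    rw [PiLp.inner_apply]
    simp [mul_comm]
  · intro i _
    exact (memLp_real_comp u i).integrable_mul (memLp_real_comp v i)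

lemma hasSum_conj_coeff_mul (u v : VField) :
    HasSum (fun k => ∑ i, (starRingEnd ℂ) (coeff u k i) * coeff v k i)
      (((((2 * Real.pi) ^ 2)⁻¹ * inner ℝ u v : ℝ)) : ℂ) := by
  have h := hasSum_sum (s := Finset.univ) fun i (_ : i ∈ Finset.univ) =>
    hasSum_conj_fcoeff_mul (memLp_comp u i) (memLp_comp v i)
  convert! h using 1
  rw [← Finset.mul_sum, inner_eq_sum_integral, Complex.ofReal_mul, Complex.ofReal_inv,
    Complex.ofReal_sum]
  congr 2
  ext i
  rw [← integral_complex_ofReal]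
  simp [comp]

lemma hasSum_norm_coeff_sq (u : VField) :
    HasSum (fun k => ∑ i, ‖coeff u k i‖ ^ 2) (((2 * Real.pi) ^ 2)⁻¹ * ‖u‖ ^ 2) := by
  rw [← Complex.hasSum_ofReal, ← real_inner_self_eq_norm_sq]
  convert! hasSum_conj_coeff_mul u u using 1
  ext k
  push_cast
  simp only [Complex.conj_mul']

lemma IsPartial.sub {j : Fin 2} {u v g h : VField} (hu : IsPartial j u g) (hv : IsPartial j v h) :
    IsPartial j (u - v) (g - h) := by
  intro k i
  rw [coeff_sub, coeff_sub, hu, hv]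
  ring

lemma eq_of_coeff_eq {u v : VField} (h : ∀ k i, coeff u k i = coeff v k i) : u = v := by
  have h1 := hasSum_norm_coeff_sq (u - v)
  simp only [coeff_sub, h, sub_self, norm_zero, ne_eq, OfNat.ofNat_ne_zero, not_false_eq_true,
    zero_pow, Finset.sum_const_zero] at h1
  have h2 := h1.unique hasSum_zero
  have h3 : ((2 * Real.pi) ^ 2)⁻¹ ≠ 0 := (inv_pos.mpr (pow_pos Real.two_pi_pos 2)).ne'
  have h4 : ‖u - v‖ ^ 2 = 0 := by simpa [h3, Real.pi_ne_zero] using h2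
  exact sub_eq_zero.mp (norm_eq_zero.mp (pow_eq_zero_iff two_ne_zero |>.mp h4))

lemma IsPartial.unique {j : Fin 2} {u g h : VField} (hg : IsPartial j u g)
    (hh : IsPartial j u h) : g = h :=
  eq_of_coeff_eq fun k i => (hg k i).trans (hh k i).symm

lemma hasSum_grad {u : VField} {g : Fin 2 → VField} (hg : ∀ j, IsPartial j u (g j)) :
    HasSum (fun k => waveLen k ^ 2 * ∑ i, ‖coeff u k i‖ ^ 2)
      (((2 * Real.pi) ^ 2)⁻¹ * ∑ j, ‖g j‖ ^ 2) := by
  rw [Finset.mul_sum]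
  convert! hasSum_sum (s := Finset.univ) fun j (_ : j ∈ Finset.univ) =>
    hasSum_norm_coeff_sq (g j) using 1
  ext k
  simp only [fun j => hg j k, norm_mul, Complex.norm_I, one_mul, mul_pow, Complex.norm_intCast,
    sq_abs, ← Finset.mul_sum, ← Finset.sum_mul]
  simp only [waveLen_sq, Fin.sum_univ_two]

lemma one_le_waveLen_sq {k : Fin 2 → ℤ} (hk : k ≠ 0) : 1 ≤ waveLen k ^ 2 := by
  rw [waveLen_sq]
  obtain ⟨i, hi⟩ := Function.ne_iff.mp hk
  have h1 : (1 : ℝ) ≤ (k i : ℝ) ^ 2 := by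
    rw [one_le_sq_iff_one_le_abs]
    exact_mod_cast Int.one_le_abs hi
  fin_cases i
  · exact h1.trans (le_add_of_nonneg_right (sq_nonneg _))
  · exact h1.trans (le_add_of_nonneg_left (sq_nonneg _))

/-- The Poincaré inequality. -/
lemma norm_sq_le_grad (u : H) {g : Fin 2 → VField}
    (hg : ∀ j, IsPartial j (u : VField) (g j)) : ‖u‖ ^ 2 ≤ ∑ j, ‖g j‖ ^ 2 := by
  have h := hasSum_le (fun k => ?_) (hasSum_norm_coeff_sq (u : VField)) (hasSum_grad hg)
  · exact le_of_mul_le_mul_left h (inv_pos.mpr (pow_pos Real.two_pi_pos 2))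
  · by_cases hk : k = 0
    · simp [hk, (mem_solenoidal.mp u.2).1]
    · exact le_mul_of_one_le_left (by positivity) (one_le_waveLen_sq hk)

/-- By Parseval both sides are the sum of `|k|² |û_k|²`, up to the same normalising factor. -/
lemma inner_stokes {u a : H} (ha : IsStokes u a) {g : Fin 2 → VField}
    (hg : ∀ j, IsPartial j (u : VField) (g j)) : inner ℝ u a = ∑ j, ‖g j‖ ^ 2 := by
  have h1 := hasSum_conj_coeff_mul (u : VField) (a : VField)
  have h2 := Complex.hasSum_ofReal.mpr (hasSum_grad hg)
  have h3 : (fun k => ∑ i, (starRingEnd ℂ) (coeff (u : VField) k i) * coeff (a : VField) k i)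
      = fun k => ((waveLen k ^ 2 * ∑ i, ‖coeff (u : VField) k i‖ ^ 2 : ℝ) : ℂ) := by
    ext k
    rw [Finset.mul_sum]
    push_cast
    refine Finset.sum_congr rfl fun i _ => ?_
    rw [ha k i, ← Complex.conj_mul']
    push_cast
    ring
  rw [h3] at h1
  have h4 := Complex.ofReal_injective (h1.unique h2)
  exact mul_left_cancel₀ (inv_pos.mpr (pow_pos Real.two_pi_pos 2)).ne' h4

lemma IsStokes.sub {u v a b : H} (ha : IsStokes u a) (hb : IsStokes v b) :
    IsStokes (u - v) (a - b) := by
  intro k i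
  rw [Submodule.coe_sub, Submodule.coe_sub, coeff_sub, coeff_sub, ha, hb]
  ring

lemma summable_one_add_waveLen_sq : Summable fun k => ((1 + waveLen k ^ 2) ^ 2)⁻¹ := by
  have h := tsum_sobolevWeight_inv_le (R := 1) le_rfl
  have h1 : ∀ k, (sobolevWeight 1 k)⁻¹ ^ 4 = ENNReal.ofReal ((1 + waveLen k ^ 2) ^ 2)⁻¹ := by
    intro k
    rw [sobolevWeight, one_pow, div_one, ← ENNReal.ofReal_inv_of_pos (by positivity),
      ← ENNReal.ofReal_pow (by positivity), inv_pow, show 4 = 2 * 2 from rfl, pow_mul,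
      Real.sq_sqrt (by positivity)]
  simp only [h1] at h
  have h2 := ENNReal.summable_toReal (ne_top_of_le_ne_top ENNReal.ofReal_ne_top h)
  refine h2.congr fun k => ?_
  rw [ENNReal.toReal_ofReal (by positivity)]

/-- Fields in the domain of the Stokes operator are essentially bounded. -/
lemma IsStokes.exists_bound {u a : H} (ha : IsStokes u a) (i : Fin 2) :
    ∃ C : ℝ, ∀ᵐ x ∂(volume : Measure Torus), ‖(u : VField) x i‖ ≤ C := by
  have hsu := (hasSum_norm_fcoeff_sq (memLp_comp (u : VField) i)).summable
  have hsa := (hasSum_norm_fcoeff_sq (memLp_comp (a : VField) i)).summable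
  obtain ⟨C, hC⟩ := exists_bound_of_summable_fcoeff (memLp_comp (u : VField) i) (by
    refine Summable.of_nonneg_of_le (fun _ => norm_nonneg _) (fun k => ?_)
      (summable_one_add_waveLen_sq.add (hsu.add hsa))
    have h1 : (1 + waveLen k ^ 2) * ‖fcoeff (comp (u : VField) i) k‖
        = ‖fcoeff (comp (u : VField) i) k‖ + ‖fcoeff (comp (a : VField) i) k‖ := by
      have h2 := ha k i
      rw [coeff_eq_fcoeff, coeff_eq_fcoeff] at h2
      rw [h2, norm_mul, Complex.norm_real, Real.norm_of_nonneg (sq_nonneg _)]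
      ring
    set p := ‖fcoeff (comp (u : VField) i) k‖
    set q := ‖fcoeff (comp (a : VField) i) k‖
    have hs : 0 < 1 + waveLen k ^ 2 := by positivity
    -- The product is at most `(1 + |k|²)⁻² / 2 + p² + q²`, and each of these is summable in two
    -- dimensions.
    have h3 : p = (1 + waveLen k ^ 2)⁻¹ * (p + q) := by
      rw [← h1, inv_mul_cancel_left₀ hs.ne']
    have h4 : 0 ≤ (((1 + waveLen k ^ 2)⁻¹) - (p + q)) ^ 2 := sq_nonneg _
    rw [← inv_pow]
    nlinarith [sq_nonneg (p - q), sq_nonneg ((1 + waveLen k ^ 2)⁻¹), sq_nonneg p, sq_nonneg q])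
  exact ⟨C, hC.mono fun x hx => by simpa [comp] using hx⟩

/-! ### Spectral truncation and the high modes -/

lemma fcoeff_sum_expMode (S : Finset (Fin 2 → ℤ)) (c : (Fin 2 → ℤ) → ℂ) (k : Fin 2 → ℤ) :
    fcoeff (fun x => ∑ l ∈ S, c l * expMode l x) k = if k ∈ S then c k else 0 := by
  have h0 : (((2 * Real.pi) ^ 2 : ℝ) : ℂ) ≠ 0 := by
    exact_mod_cast (pow_pos Real.two_pi_pos 2).ne'
  have h1 : ∀ x : Torus, (starRingEnd ℂ) (expMode k x) * ∑ l ∈ S, c l * expMode l x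
      = ∑ l ∈ S, c l * expMode (l - k) x := by
    intro x
    rw [Finset.mul_sum]
    refine Finset.sum_congr rfl fun l _ => ?_
    rw [sub_eq_add_neg, expMode_add, expMode_neg]
    ring
  have hi : ∀ l, Integrable (fun x => c l * expMode (l - k) x) (volume : Measure Torus) :=
    fun l => ((expMode (l - k)).continuous.integrable_of_hasCompactSupport
      (HasCompactSupport.of_compactSpace _)).const_mul _
  unfold fcoeff
  simp only [h1]
  rw [integral_finsetSum _ fun l _ => hi l]
  simp only [integral_const_mul, integral_expMode, sub_eq_zero]
  simp only [mul_ite, mul_zero, Finset.sum_ite_eq']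
  split_ifs
  · rw [mul_comm (c k), inv_mul_cancel_left₀ h0]
  · simp

lemma finite_waveLen_le (N : ℝ) : {k : Fin 2 → ℤ | waveLen k ≤ N}.Finite := by
  refine (Set.finite_Icc (fun _ : Fin 2 => -⌈N⌉) (fun _ => ⌈N⌉)).subset fun k hk => ?_
  have hb : ∀ i, |(k i : ℝ)| ≤ N := by
    intro i
    refine le_trans ?_ hk
    rw [waveLen, ← Real.sqrt_sq_eq_abs]
    exact Real.sqrt_le_sqrt (Finset.single_le_sum (f := fun i => (k i : ℝ) ^ 2)
      (fun _ _ => sq_nonneg _) (Finset.mem_univ i))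
  refine ⟨fun i => ?_, fun i => ?_⟩
  · have h1 := (neg_le_of_abs_le (hb i))
    have h2 := Int.le_ceil N
    have h3 : ((-⌈N⌉ : ℤ) : ℝ) ≤ k i := by push_cast; linarith
    exact_mod_cast h3
  · have h1 := (le_of_abs_le (hb i)).trans (Int.le_ceil N)
    exact_mod_cast h1

lemma waveLen_neg (k : Fin 2 → ℤ) : waveLen (-k) = waveLen k := by
  simp [waveLen]

lemma coeff_neg (u : VField) (k : Fin 2 → ℤ) (i : Fin 2) :
    coeff u (-k) i = (starRingEnd ℂ) (coeff u k i) := by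
  unfold coeff
  rw [map_mul, ← integral_conj, map_inv₀, Complex.conj_ofReal]
  congr 2
  ext x
  rw [expMode_neg]
  simp

/-- The sharp truncation of a field to the wavenumbers `|k| ≤ N`. -/
lemma exists_truncation (u : VField) (N : ℝ) :
    ∃ r : VField, ∀ k i, coeff r k i = if waveLen k ≤ N then coeff u k i else 0 := by
  classical
  set S := (finite_waveLen_le N).toFinset with hS
  have hmem : ∀ k, k ∈ S ↔ waveLen k ≤ N := fun k => by simp [hS]
  set F : Fin 2 → Torus → ℂ := fun i x => ∑ l ∈ S, coeff u l i * expMode l x with hF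
  -- The set of retained wavenumbers is symmetric, and the coefficients of a real field at `k` and
  -- `-k` are conjugate.
  have hreal : ∀ i x, ((F i x).re : ℂ) = F i x := by
    intro i x
    refine Complex.conj_eq_iff_re.mp ?_
    rw [hF]
    simp only [map_sum, map_mul, ← coeff_neg, ← expMode_neg]
    exact Finset.sum_bij' (fun l _ => -l) (fun l _ => -l)
      (fun l hl => by rw [hmem, waveLen_neg, ← hmem]; exact hl)
      (fun l hl => by rw [hmem, waveLen_neg, ← hmem]; exact hl)
      (fun l _ => neg_neg l) (fun l _ => neg_neg l) (fun l _ => rfl)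
  have hcont : ∀ i, Continuous (F i) := fun i => by
    rw [hF]
    fun_prop
  let G : C(Torus, EuclideanSpace ℝ (Fin 2)) :=
    ⟨fun x => WithLp.toLp 2 fun i => (F i x).re,
      (PiLp.continuous_toLp 2 _).comp (continuous_pi fun i => Complex.continuous_re.comp (hcont i))⟩
  refine ⟨ContinuousMap.toLp (E := EuclideanSpace ℝ (Fin 2)) 2 volume ℝ G, fun k i => ?_⟩
  have h1 : comp (ContinuousMap.toLp (E := EuclideanSpace ℝ (Fin 2)) 2 volume ℝ G) i
      =ᵐ[volume] F i := by
    filter_upwards [ContinuousMap.coeFn_toLp (p := 2) (𝕜 := ℝ) (volume : Measure Torus) G] with x hx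
    rw [comp, hx]
    exact hreal i x
  rw [coeff_eq_fcoeff, fcoeff_congr h1, hF, fcoeff_sum_expMode]
  simp only [hmem]

/-- The Bernstein type inequality for the high modes. -/
lemma sq_mul_norm_sub_lowProj_sq_le (w : H) {N : ℝ} (hN : 0 < N) {g : Fin 2 → VField}
    (hg : ∀ j, IsPartial j (w : VField) (g j)) :
    N ^ 2 * ‖w - lowProj N w‖ ^ 2 ≤ ∑ j, ‖g j‖ ^ 2 := by
  obtain ⟨r, hr⟩ := exists_truncation (w : VField) N
  have hrs : r ∈ solenoidal := by
    obtain ⟨h1, h2⟩ := mem_solenoidal.mp w.2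
    refine mem_solenoidal.mpr ⟨fun i => ?_, fun k => ?_⟩
    · rw [hr, h1, ite_self]
    · simp only [hr]
      split_ifs
      · exact h2 k
      · simp
  let r' : H := ⟨r, hrs⟩
  have hlow : r' ∈ lowModes N := mem_lowModes.mpr fun k hk i => by
    change coeff r k i = 0
    rw [hr, if_neg (not_le.mpr hk)]
  -- The projection is the closest point of `lowModes N`, so comparison with the explicit truncation
  -- suffices; the coefficients of the projection itself are never computed.
  have hmin : ‖w - lowProj N w‖ ≤ ‖w - r'‖ := by
    rw [lowProj, Submodule.starProjection_minimal]
    exact ciInf_le ⟨0, by rintro _ ⟨x, rfl⟩; exact norm_nonneg _⟩ (⟨r', hlow⟩ : lowModes N)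
  have h2 : N ^ 2 * ‖w - r'‖ ^ 2 ≤ ∑ j, ‖g j‖ ^ 2 := by
    have h := hasSum_le (fun k => ?_) ((hasSum_norm_coeff_sq ((w : VField) - r)).mul_left (N ^ 2))
      (hasSum_grad hg)
    · have h3 : 0 < ((2 * Real.pi) ^ 2)⁻¹ := inv_pos.mpr (pow_pos Real.two_pi_pos 2)
      refine le_of_mul_le_mul_left (le_of_eq_of_le ?_ h) h3
      rw [show ‖w - r'‖ = ‖(w : VField) - r‖ from rfl]
      ring
    · simp only [coeff_sub, hr]
      split_ifs with hk
      · simp only [sub_self, norm_zero, ne_eq, OfNat.ofNat_ne_zero, not_false_eq_true, zero_pow,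
          Finset.sum_const_zero, mul_zero]
        positivity
      · simp only [sub_zero]
        have := not_le.mp hk
        gcongr
  refine le_trans ?_ h2
  gcongr

lemma inner_lowProj (N : ℝ) (w : H) : inner ℝ w (lowProj N w) = ‖lowProj N w‖ ^ 2 := by
  have h := (lowModes N).starProjection_inner_eq_zero w ((lowModes N).starProjection w)
    ((lowModes N).starProjection_apply_mem w)
  rw [inner_sub_left, real_inner_self_eq_norm_sq] at h
  exact sub_eq_zero.mp h

lemma norm_sq_eq_lowProj (N : ℝ) (w : H) :
    ‖w‖ ^ 2 = ‖lowProj N w‖ ^ 2 + ‖w - lowProj N w‖ ^ 2 := by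
  rw [norm_sub_sq_real, inner_lowProj]
  ring

/-! ### The trilinear form and Ladyzhenskaya's inequality -/

/-- The product rule `g p = ∂_j (p²) / 2` for `g = ∂_j p`, in terms of Fourier coefficients. -/
lemma fcoeff_partial_mul {p g : Torus → ℂ} (hp : MemLp p 2 volume) (hg : MemLp g 2 volume)
    {j : Fin 2} (h : ∀ k, fcoeff g k = Complex.I * (k j : ℂ) * fcoeff p k) (n : Fin 2 → ℤ) :
    fcoeff (fun x => g x * p x) n
      = Complex.I * (n j : ℂ) / 2 * fcoeff (fun x => p x * p x) n := by
  have h1 := hasSum_fcoeff_mul hg hp n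
  have h2 := hasSum_fcoeff_mul hp hg n
  have h3 := (hasSum_fcoeff_mul hp hp n).mul_left (Complex.I * (n j : ℂ))
  have h4 : fcoeff (fun x => p x * g x) n = fcoeff (fun x => g x * p x) n := by
    simp only [mul_comm]
  -- The two convolutions carry the factors `(n - k)_j` and `k_j`, which add up to `n_j`.
  have h5 := (h1.add h2).unique (a₂ := Complex.I * (n j : ℂ) * fcoeff (fun x => p x * p x) n) (by
    convert! h3 using 2 with k
    rw [h, h, Pi.sub_apply]
    push_cast
    ring)
  rw [h4] at h5
  linear_combination h5 / 2

lemma memLp_mul_of_bound {p q : Torus → ℝ} (hp : MemLp p 2 volume) (hq : MemLp q 2 volume)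
    (hb : ∃ C : ℝ, ∀ᵐ x ∂(volume : Measure Torus), ‖q x‖ ≤ C) :
    MemLp (fun x => p x * q x) 2 (volume : Measure Torus) := by
  obtain ⟨C, hC⟩ := hb
  refine MemLp.of_le_mul (c := C) hp (hp.1.mul hq.1) ?_
  filter_upwards [hC] with x hx
  rw [norm_mul, mul_comm]
  gcongr

/-- Orthogonality `∫ ((v · ∇) w) · w = 0`. -/
lemma sum_integral_convection_self_eq_zero (v : H) {w : VField} {g : Fin 2 → VField}
    (hg : ∀ j, IsPartial j w (g j))
    (hb : ∀ i, ∃ C : ℝ, ∀ᵐ x ∂(volume : Measure Torus), ‖w x i‖ ≤ C) :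
    ∑ j, ∑ i, ∫ x, (v : VField) x j * (g j x i * w x i) = 0 := by
  have hm : ∀ j i, MemLp (fun x => comp (g j) i x * comp w i x) 2 (volume : Measure Torus) := by
    intro j i
    have h1 := Complex.ofRealCLM.comp_memLp'
      (memLp_mul_of_bound (memLp_real_comp (g j) i) (memLp_real_comp w i) (hb i))
    simpa [Function.comp_def, comp] using h1
  have h1 := hasSum_sum (s := Finset.univ) fun j (_ : j ∈ Finset.univ) =>
    hasSum_sum (s := Finset.univ) fun i (_ : i ∈ Finset.univ) =>
      hasSum_conj_fcoeff_mul (memLp_comp (v : VField) j) (hm j i)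
  have h2 : (fun k => ∑ j, ∑ i, (starRingEnd ℂ) (fcoeff (comp (v : VField) j) k) *
      fcoeff (fun x => comp (g j) i x * comp w i x) k) = fun _ => 0 := by
    ext k
    have h3 := congrArg (starRingEnd ℂ) ((mem_solenoidal.mp v.2).2 k)
    simp only [map_sum, map_mul, map_zero, map_intCast] at h3
    have h4 : ∀ j i, fcoeff (fun x => comp (g j) i x * comp w i x) k
        = Complex.I * (k j : ℂ) / 2 * fcoeff (fun x => comp w i x * comp w i x) k :=
      fun j i => fcoeff_partial_mul (memLp_comp w i) (memLp_comp (g j) i) (fun k => hg j k i) k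
    simp only [h4]
    simp only [coeff_eq_fcoeff, Fin.sum_univ_two] at h3 ⊢
    -- The coefficient of `|w|²` does not depend on `j`, so `k · v̂_k = 0` factors out.
    linear_combination (Complex.I / 2 * (fcoeff (fun x => comp w 0 x * comp w 0 x) k
      + fcoeff (fun x => comp w 1 x * comp w 1 x) k)) * h3
  rw [h2] at h1
  have h5 := h1.unique hasSum_zero
  simp only [← Finset.mul_sum] at h5
  have h0 : (((2 * Real.pi) ^ 2 : ℝ) : ℂ)⁻¹ ≠ 0 := by
    refine inv_ne_zero ?_
    exact_mod_cast (pow_pos Real.two_pi_pos 2).ne'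
  have h6 := (mul_eq_zero.mp h5).resolve_left h0
  rw [← Complex.ofReal_eq_zero, ← h6]
  push_cast
  refine Finset.sum_congr rfl fun j _ => Finset.sum_congr rfl fun i _ => ?_
  rw [← integral_complex_ofReal]
  simp [comp]

lemma inner_convection {u w y : VField} {g : Fin 2 → VField}
    (hy : y =ᵐ[volume] fun x => ∑ j, u x j • (g j) x)
    (hb : ∀ i, ∃ C : ℝ, ∀ᵐ x ∂(volume : Measure Torus), ‖w x i‖ ≤ C) :
    inner ℝ w y = ∑ j, ∑ i, ∫ x, u x j * (g j x i * w x i) := by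
  have hint : ∀ j i, Integrable (fun x => u x j * (g j x i * w x i)) (volume : Measure Torus) :=
    fun j i => (memLp_real_comp u j).integrable_mul
      (memLp_mul_of_bound (memLp_real_comp (g j) i) (memLp_real_comp w i) (hb i))
  rw [inner_eq_sum_integral, Finset.sum_comm]
  refine Finset.sum_congr rfl fun i _ => ?_
  rw [← integral_finsetSum _ fun j _ => hint j i]
  refine integral_congr_ae ?_
  filter_upwards [hy] with x hx
  simp only [hx, Fin.sum_univ_two, PiLp.add_apply, PiLp.smul_apply, smul_eq_mul]
  ring

/-- The Leray projection drops out against a test field in `H`, and uniqueness of weak derivatives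
allows any given gradient of `v`. -/
lemma IsConvection.inner_eq {u v b : H} (h : IsConvection u v b) {g : Fin 2 → VField}
    (hg : ∀ j, IsPartial j (v : VField) (g j)) {w : H}
    (hb : ∀ i, ∃ C : ℝ, ∀ᵐ x ∂(volume : Measure Torus), ‖(w : VField) x i‖ ≤ C) :
    inner ℝ w b = ∑ j, ∑ i, ∫ x, (u : VField) x j * (g j x i * (w : VField) x i) := by
  obtain ⟨g', hg', y, hy, rfl⟩ := h
  obtain rfl : g' = g := funext fun j => (hg' j).unique (hg j)
  rw [← inner_convection hy hb, leray]
  exact Submodule.inner_orthogonalProjectionOnto_eq_of_mem_left w y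

/-- With `w = v - u`, one has `(v · ∇)v - (u · ∇)u = (v · ∇)w + (w · ∇)u`, and the first term is
orthogonal to `w`. -/
lemma sum_integral_convection_sub (v u : H) {gv gu : Fin 2 → VField}
    (hgv : ∀ j, IsPartial j (v : VField) (gv j)) (hgu : ∀ j, IsPartial j (u : VField) (gu j))
    (hb : ∀ i, ∃ C : ℝ, ∀ᵐ x ∂(volume : Measure Torus), ‖((v - u : H) : VField) x i‖ ≤ C) :
    (∑ j, ∑ i, ∫ x, (v : VField) x j * (gv j x i * ((v - u : H) : VField) x i))
      - ∑ j, ∑ i, ∫ x, (u : VField) x j * (gu j x i * ((v - u : H) : VField) x i)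
    = ∑ j, ∑ i, ∫ x, ((v - u : H) : VField) x j * (gu j x i * ((v - u : H) : VField) x i) := by
  have hint : ∀ (a b : VField) (j i : Fin 2), Integrable
      (fun x => a x j * (b x i * ((v - u : H) : VField) x i)) (volume : Measure Torus) :=
    fun a b j i => (memLp_real_comp a j).integrable_mul
      (memLp_mul_of_bound (memLp_real_comp b i) (memLp_real_comp _ i) (hb i))
  have h0 := sum_integral_convection_self_eq_zero v (w := ((v - u : H) : VField))
    (g := fun j => gv j - gu j) (fun j => (hgv j).sub (hgu j)) hb
  rw [← sub_eq_zero, ← h0, ← Finset.sum_sub_distrib, ← Finset.sum_sub_distrib]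
  refine Finset.sum_congr rfl fun j _ => ?_
  rw [← Finset.sum_sub_distrib, ← Finset.sum_sub_distrib]
  refine Finset.sum_congr rfl fun i _ => ?_
  rw [← integral_sub (hint _ _ _ _) (hint _ _ _ _), ← integral_sub ?_ (hint _ _ _ _)]
  · refine integral_congr_ae ?_
    filter_upwards [Lp.coeFn_sub (v : VField) (u : VField), Lp.coeFn_sub (gv j) (gu j)]
      with x h1 h2
    have h3 : ∀ l, ((v - u : H) : VField) x l = (v : VField) x l - (u : VField) x l := fun l => by
      rw [Submodule.coe_sub, h1, Pi.sub_apply, PiLp.sub_apply]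
    rw [h2]
    simp only [h3, Pi.sub_apply, PiLp.sub_apply]
    ring
  · exact (hint _ _ _ _).sub (hint _ _ _ _)

lemma integral_mul_sq_le {p q : Torus → ℝ} (hp : MemLp p 2 volume) (hq : MemLp q 2 volume) :
    (∫ x, p x * q x) ^ 2 ≤ (∫ x, p x ^ 2) * ∫ x, q x ^ 2 := by
  have h := real_inner_mul_inner_self_le (hp.toLp p) (hq.toLp q)
  have key : ∀ {p q : Torus → ℝ} (hp : MemLp p 2 volume) (hq : MemLp q 2 volume),
      inner ℝ (hp.toLp p) (hq.toLp q) = ∫ x, p x * q x := by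
    intro p q hp hq
    rw [L2.inner_def]
    refine integral_congr_ae ?_
    filter_upwards [hp.coeFn_toLp, hq.coeFn_toLp] with x h1 h2
    rw [h1, h2]
    simp [mul_comm]
  rw [key, key, key] at h
  simpa only [pow_two] using h

lemma integral_comp_sq_le (u : VField) (i : Fin 2) : ∫ x, u x i ^ 2 ≤ ‖u‖ ^ 2 := by
  rw [← real_inner_self_eq_norm_sq, inner_eq_sum_integral]
  simp only [pow_two]
  exact Finset.single_le_sum (f := fun i => ∫ x, u x i * u x i)
    (fun i _ => integral_nonneg fun x => mul_self_nonneg _) (Finset.mem_univ i)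

/-- The Ladyzhenskaya inequality. -/
lemma integral_comp_mul_comp_sq_le (w : H) {g : Fin 2 → VField}
    (hg : ∀ j, IsPartial j (w : VField) (g j))
    (hb : ∀ i, ∃ C : ℝ, ∀ᵐ x ∂(volume : Measure Torus), ‖(w : VField) x i‖ ≤ C) (j i : Fin 2) :
    ∫ x, ((w : VField) x j * (w : VField) x i) ^ 2 ≤ 100 * (‖w‖ ^ 2 * ∑ j, ‖g j‖ ^ 2) := by
  obtain ⟨c, hc⟩ : ∃ c : ℝ, c = ((2 * Real.pi) ^ 2)⁻¹ := ⟨_, rfl⟩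
  have hc0 : 0 < c := hc ▸ inv_pos.mpr (pow_pos Real.two_pi_pos 2)
  have hc1 : c ≤ 1 := by
    rw [hc]
    refine inv_le_one_of_one_le₀ ?_
    nlinarith [Real.pi_gt_three]
  have hP := norm_sq_le_grad w hg
  have hgrad := hasSum_grad hg
  have hnorm := hasSum_norm_coeff_sq (w : VField)
  rw [← hc] at hgrad hnorm
  obtain ⟨D, hD⟩ : ∃ D : ℝ, D = ∑ j, ‖g j‖ ^ 2 := ⟨_, rfl⟩
  rw [← hD] at hP hgrad ⊢
  rcases eq_or_ne w 0 with rfl | hw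
  · have : ∫ x, (((0 : H) : VField) x j * ((0 : H) : VField) x i) ^ 2 = 0 := by
      rw [integral_eq_zero_iff_of_nonneg_ae (Eventually.of_forall fun x => sq_nonneg _)]
      · filter_upwards [Lp.coeFn_zero (EuclideanSpace ℝ (Fin 2)) 2 (volume : Measure Torus)]
          with x hx
        rw [Submodule.coe_zero, hx]
        simp
      · exact (memLp_mul_of_bound (memLp_real_comp _ j) (memLp_real_comp _ i) (hb i)).integrable_sq
    rw [this, norm_zero]
    simp
  have hw0 : 0 < ‖w‖ := norm_pos_iff.mpr hw
  have hD0 : 0 < D := lt_of_lt_of_le (by positivity) hP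
  -- This scale balances the two parts of the weighted sum, making it `2c‖w‖²`; Poincaré's
  -- inequality gives `R ≥ 1`.
  obtain ⟨R, hR⟩ : ∃ R : ℝ, R = Real.sqrt D / ‖w‖ := ⟨_, rfl⟩
  have hR2 : R ^ 2 = D / ‖w‖ ^ 2 := by rw [hR, div_pow, Real.sq_sqrt hD0.le]
  have hφ : ∀ k, 0 ≤ 1 + waveLen k ^ 2 / R ^ 2 := fun k =>
    add_nonneg zero_le_one (div_nonneg (sq_nonneg _) (sq_nonneg _))
  have hR1 : 1 ≤ R := by
    rw [hR, one_le_div hw0]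
    exact Real.le_sqrt_of_sq_le hP
  have hsum : HasSum (fun k => (1 + waveLen k ^ 2 / R ^ 2) * ∑ i, ‖coeff (w : VField) k i‖ ^ 2)
      (2 * c * ‖w‖ ^ 2) := by
    convert! hnorm.add (hgrad.mul_left (R ^ 2)⁻¹) using 1
    · ext k
      ring
    · rw [hR2, show ‖(w : VField)‖ = ‖w‖ from rfl]
      field_simp
      ring
  have hle : ∀ i k, (1 + waveLen k ^ 2 / R ^ 2) * ‖fcoeff (comp (w : VField) i) k‖ ^ 2
      ≤ (1 + waveLen k ^ 2 / R ^ 2) * ∑ i, ‖coeff (w : VField) k i‖ ^ 2 := by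
    intro i k
    have h : ‖coeff (w : VField) k i‖ ^ 2 ≤ ∑ i, ‖coeff (w : VField) k i‖ ^ 2 :=
      Finset.single_le_sum (f := fun i => ‖coeff (w : VField) k i‖ ^ 2)
        (fun _ _ => sq_nonneg _) (Finset.mem_univ i)
    exact mul_le_mul_of_nonneg_left h (hφ k)
  have hs : ∀ i, Summable fun k =>
      (1 + waveLen k ^ 2 / R ^ 2) * ‖fcoeff (comp (w : VField) i) k‖ ^ 2 := fun i =>
    Summable.of_nonneg_of_le (fun k => mul_nonneg (hφ k) (sq_nonneg _)) (hle i) hsum.summable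
  have hA : ∀ i, ∑' k, (1 + waveLen k ^ 2 / R ^ 2) * ‖fcoeff (comp (w : VField) i) k‖ ^ 2
      ≤ 2 * c * ‖w‖ ^ 2 := fun i => hasSum_le (hle i) (hs i).hasSum hsum
  have hm : MemLp (fun x => comp (w : VField) j x * comp (w : VField) i x) 2
      (volume : Measure Torus) := by
    have h1 := Complex.ofRealCLM.comp_memLp'
      (memLp_mul_of_bound (memLp_real_comp (w : VField) j) (memLp_real_comp (w : VField) i) (hb i))
    simpa [Function.comp_def, comp] using h1
  have h1 := integral_norm_mul_sq_le (memLp_comp (w : VField) j) (memLp_comp (w : VField) i) hm hR1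
    (hs j).hasSum (hs i).hasSum
  have h2 : ∫ x, ‖comp (w : VField) j x * comp (w : VField) i x‖ ^ 2
      = ∫ x, ((w : VField) x j * (w : VField) x i) ^ 2 := by
    congr 1
    ext x
    simp only [comp]
    rw [← Complex.ofReal_mul, Complex.norm_real, Real.norm_eq_abs, sq_abs]
  rw [h2, ← hc] at h1
  have h3 : 25 * R ^ 2 *
      ((∑' k, (1 + waveLen k ^ 2 / R ^ 2) * ‖fcoeff (comp (w : VField) j) k‖ ^ 2) *
      ∑' k, (1 + waveLen k ^ 2 / R ^ 2) * ‖fcoeff (comp (w : VField) i) k‖ ^ 2)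
      ≤ 25 * R ^ 2 * ((2 * c * ‖w‖ ^ 2) * (2 * c * ‖w‖ ^ 2)) := by
    gcongr
    · exact hA j
    · exact hA i
  have h4 : 25 * R ^ 2 * ((2 * c * ‖w‖ ^ 2) * (2 * c * ‖w‖ ^ 2))
      = c * (c * (100 * (‖w‖ ^ 2 * D))) := by
    rw [hR2]
    field_simp
    ring
  have h5 := le_of_mul_le_mul_left ((h1.trans h3).trans h4.le) hc0
  exact h5.trans (mul_le_of_le_one_left (by positivity) hc1)

/-- The basic estimate of the trilinear form. -/
lemma abs_sum_integral_convection_le (w : H) {g G : Fin 2 → VField}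
    (hg : ∀ j, IsPartial j (w : VField) (g j))
    (hb : ∀ i, ∃ C : ℝ, ∀ᵐ x ∂(volume : Measure Torus), ‖(w : VField) x i‖ ≤ C) :
    |∑ j, ∑ i, ∫ x, (w : VField) x j * (G j x i * (w : VField) x i)| ≤
      40 * (‖w‖ * Real.sqrt (∑ j, ‖g j‖ ^ 2) * Real.sqrt (∑ j, ‖G j‖ ^ 2)) := by
  -- The 10 is the square root of Ladyzhenskaya's constant 100; the four index pairs turn it into
  -- 40.
  set K := 10 * (‖w‖ * Real.sqrt (∑ j, ‖g j‖ ^ 2) * Real.sqrt (∑ j, ‖G j‖ ^ 2)) with hK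
  have key : ∀ j i, |∫ x, (w : VField) x j * (G j x i * (w : VField) x i)| ≤ K := by
    intro j i
    refine abs_le_of_sq_le_sq ?_ (by positivity)
    have h1 := integral_mul_sq_le
      (memLp_mul_of_bound (memLp_real_comp (w : VField) j) (memLp_real_comp (w : VField) i) (hb i))
      (memLp_real_comp (G j) i)
    have h2 : ∫ x, (w : VField) x j * (w : VField) x i * G j x i
        = ∫ x, (w : VField) x j * (G j x i * (w : VField) x i) := by
      congr 1
      ext x
      ring
    rw [h2] at h1
    refine h1.trans ?_
    calc _ ≤ (100 * (‖w‖ ^ 2 * ∑ j, ‖g j‖ ^ 2)) * ∑ j, ‖G j‖ ^ 2 := by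
          gcongr
          · exact integral_comp_mul_comp_sq_le w hg hb j i
          · exact (integral_comp_sq_le (G j) i).trans (Finset.single_le_sum
              (f := fun j => ‖G j‖ ^ 2) (fun _ _ => sq_nonneg _) (Finset.mem_univ j))
      _ = K ^ 2 := by
          rw [hK, mul_pow, mul_pow, mul_pow, Real.sq_sqrt (by positivity),
            Real.sq_sqrt (by positivity)]
          ring
  calc _ ≤ ∑ j : Fin 2, ∑ i : Fin 2, K :=
        (Finset.abs_sum_le_sum_abs _ _).trans (Finset.sum_le_sum fun j _ =>
          (Finset.abs_sum_le_sum_abs _ _).trans (Finset.sum_le_sum fun i _ => key j i))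
    _ = _ := by
        rw [Finset.sum_const, Finset.sum_const, hK]
        simp only [Finset.card_univ, Fintype.card_fin, nsmul_eq_mul]
        push_cast
        ring

/-! ### Differential inequalities for solutions and synchronization -/

lemma LocallySqIntegrable.intervalIntegrable {F : ℝ → H} (hF : LocallySqIntegrable F) (T : ℝ)
    (hT : 0 < T) : IntervalIntegrable F volume 0 T := by
  rw [intervalIntegrable_iff_integrableOn_Ioo_of_le hT.le]
  exact (hF T hT).integrable (by norm_num)

lemma EssBounded.ae_norm_le {f : ℝ → H} (hf : EssBounded f) :
    ∀ᵐ t ∂(volume.restrict (Set.Ioi (0 : ℝ))), ‖f t‖ ≤ supNorm f := by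
  have h := ae_le_eLpNormEssSup (f := f) (μ := volume.restrict (Set.Ioi (0 : ℝ)))
  filter_upwards [h] with t ht
  rw [← eLpNorm_exponent_top] at ht
  rw [supNorm, ← toReal_enorm]
  exact ENNReal.toReal_mono hf.eLpNorm_lt_top.ne ht

lemma supNorm_nonneg (f : ℝ → H) : 0 ≤ supNorm f := ENNReal.toReal_nonneg

lemma inner_smul_right_solenoidal (c : ℝ) (x y : H) : inner ℝ x (c • y) = c * inner ℝ x y :=
  real_inner_smul_right x y c

/-- The energy inequality at a fixed time. -/
lemma two_mul_inner_le_of_equation {u u' a b f : H} {ν F : ℝ} (hν : 0 < ν) (hF : ‖f‖ ≤ F)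
    {g : Fin 2 → VField} (hg : ∀ j, IsPartial j (u : VField) (g j)) (ha : IsStokes u a)
    (hb : IsConvection u u b) (he : u' + ν • a + b = f) :
    2 * inner ℝ u u' ≤ F ^ 2 / ν - ν * ∑ j, ‖g j‖ ^ 2 := by
  have hbd := ha.exists_bound
  have h1 : inner ℝ u b = 0 := by
    rw [hb.inner_eq hg hbd]
    exact sum_integral_convection_self_eq_zero u hg hbd
  have h2 : u' = f - ν • a - b := by rw [← he]; abel
  have h3 : inner ℝ u u' = inner ℝ u f - ν * ∑ j, ‖g j‖ ^ 2 := by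
    rw [h2, inner_sub_right, inner_sub_right, h1, inner_smul_right_solenoidal,
      inner_stokes ha hg, sub_zero]
  have h4 : inner ℝ u f ≤ ‖u‖ * F := (real_inner_le_norm u f).trans (by gcongr)
  have h5 := mul_le_mul_of_nonneg_left (norm_sq_le_grad u hg) hν.le
  have h6 : 2 * (‖u‖ * F) ≤ ν * ‖u‖ ^ 2 + F ^ 2 / ν := by
    have h7 : ν * ‖u‖ ^ 2 + F ^ 2 / ν - 2 * (‖u‖ * F) = (ν * ‖u‖ - F) ^ 2 / ν := by
      field_simp
      ring
    have h8 : 0 ≤ (ν * ‖u‖ - F) ^ 2 / ν := by positivity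
    linarith
  rw [h3]
  linarith

/-- The differential inequality for the synchronization error at a fixed time. -/
lemma two_mul_inner_le_of_nudging {v u v' u' av au bv bu f : H} {ν μ N : ℝ} (hν : 0 < ν)
    (hN : 0 < N) {gv gu : Fin 2 → VField} (hgv : ∀ j, IsPartial j (v : VField) (gv j))
    (hgu : ∀ j, IsPartial j (u : VField) (gu j)) (hav : IsStokes v av) (hau : IsStokes u au)
    (hbv : IsConvection v v bv) (hbu : IsConvection u u bu)
    (hev : v' + ν • av + bv = f - μ • lowProj N v + μ • lowProj N u)
    (heu : u' + ν • au + bu = f) :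
    2 * inner ℝ (v - u) (v' - u') ≤
      (-min (ν * N ^ 2) (2 * μ) + 1600 / ν * ∑ j, ‖gu j‖ ^ 2) * ‖v - u‖ ^ 2 := by
  have hg : ∀ j, IsPartial j ((v - u : H) : VField) (gv j - gu j) :=
    fun j => (hgv j).sub (hgu j)
  have ha := hav.sub hau
  have hbd := ha.exists_bound
  have h1 := sum_integral_convection_sub v u hgv hgu hbd
  rw [← hbv.inner_eq hgv hbd, ← hbu.inner_eq hgu hbd, ← inner_sub_right] at h1
  have h2 := abs_sum_integral_convection_le (v - u) (G := gu) hg hbd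
  rw [← h1] at h2
  have h3 : v' - u' = -(μ • lowProj N (v - u)) - ν • (av - au) - (bv - bu) := by
    have e1 : v' = f - μ • lowProj N v + μ • lowProj N u - ν • av - bv := by rw [← hev]; abel
    have e2 : u' = f - ν • au - bu := by rw [← heu]; abel
    rw [e1, e2, map_sub, smul_sub, smul_sub]
    abel
  have h4 : inner ℝ (v - u) (v' - u') = -(μ * ‖lowProj N (v - u)‖ ^ 2)
      - ν * (∑ j, ‖gv j - gu j‖ ^ 2) - inner ℝ (v - u) (bv - bu) := by
    rw [h3, inner_sub_right, inner_sub_right, inner_neg_right, inner_smul_right_solenoidal,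
      inner_smul_right_solenoidal, inner_lowProj, inner_stokes ha hg]
  have h5 := norm_sq_eq_lowProj N (v - u)
  have h6 := sq_mul_norm_sub_lowProj_sq_le (v - u) hN hg
  have hD0 : 0 ≤ ∑ j, ‖gv j - gu j‖ ^ 2 := Finset.sum_nonneg fun _ _ => sq_nonneg _
  have hE0 : 0 ≤ ∑ j, ‖gu j‖ ^ 2 := Finset.sum_nonneg fun _ _ => sq_nonneg _
  generalize ∑ j, ‖gv j - gu j‖ ^ 2 = D at *
  generalize ∑ j, ‖gu j‖ ^ 2 = E at *
  generalize inner ℝ (v - u) (bv - bu) = I at *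
  generalize ‖lowProj N (v - u)‖ = p at *
  generalize ‖v - u - lowProj N (v - u)‖ = q at *
  generalize ‖v - u‖ = r at *
  -- Young's inequality, weighted to use exactly half of the dissipation `2νD`; `1600 = 40²`.
  have h7 : 2 * (40 * (r * Real.sqrt D * Real.sqrt E)) ≤ ν * D + 1600 / ν * E * r ^ 2 := by
    have e1 : ν * Real.sqrt D ^ 2 + 1600 / ν * Real.sqrt E ^ 2 * r ^ 2
        - 2 * (40 * (r * Real.sqrt D * Real.sqrt E))
        = (ν * Real.sqrt D - 40 * r * Real.sqrt E) ^ 2 / ν := by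
      field_simp
      ring
    have e2 : 0 ≤ (ν * Real.sqrt D - 40 * r * Real.sqrt E) ^ 2 / ν := by positivity
    rw [Real.sq_sqrt hD0, Real.sq_sqrt hE0] at e1
    linarith
  have h8 := neg_le_of_abs_le h2
  have h9 := mul_le_mul_of_nonneg_left h6 hν.le
  -- The remaining half of the dissipation damps the high modes `q` at rate `νN²`, and the nudging
  -- damps the low modes `p` at rate `2μ`.
  have h10 := mul_le_mul_of_nonneg_right (min_le_left (ν * N ^ 2) (2 * μ)) (sq_nonneg q)
  have h11 := mul_le_mul_of_nonneg_right (min_le_right (ν * N ^ 2) (2 * μ)) (sq_nonneg p)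
  generalize min (ν * N ^ 2) (2 * μ) = γ at *
  have h12 : (-γ + 1600 / ν * E) * r ^ 2 = -(γ * p ^ 2) - γ * q ^ 2 + 1600 / ν * E * r ^ 2 := by
    rw [h5]
    ring
  rw [h4, h12]
  linarith

/-- Fixes one gradient curve, continuous in time, for use in all time integrals; `A u` and `B(u,u)`
are needed only at almost every time. -/
lemma IsStrongSolution.exists_deriv_grad {ν : ℝ} {f : ℝ → H} {u₀ : H} {u : ℝ → H}
    (h : IsStrongSolution ν f u₀ u) :
    ∃ (u' : ℝ → H) (g : Fin 2 → ℝ → VField),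
      (∀ j, ContinuousOn (g j) (Set.Ici 0)) ∧
      (∀ T, 0 < T → IntervalIntegrable u' volume 0 T) ∧
      (∀ t, 0 ≤ t → u t = u 0 + ∫ s in (0 : ℝ)..t, u' s) ∧
      ∀ᵐ t ∂(volume.restrict (Set.Ioi (0 : ℝ))),
        (∀ j, IsPartial j (u t : VField) (g j t)) ∧
          ∃ a b : H, IsStokes (u t) a ∧ IsConvection (u t) (u t) b ∧
            u' t + ν • a + b = f t := by
  obtain ⟨u', a, b, h1, -, h3, h4⟩ := h.equation
  obtain ⟨-, g, hg⟩ := h.continuousInV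
  refine ⟨u', g, fun j => (hg j).1, h1.intervalIntegrable, h3, ?_⟩
  filter_upwards [h4, ae_restrict_mem measurableSet_Ioi] with t ht ht0
  exact ⟨fun j => (hg j).2 t (le_of_lt ht0), a t, b t, ht⟩

/-- Exponential synchronization when the nudging dominates the mean dissipation. -/
lemma IsNudgingSolution.tendsto_norm_sub {ν μ N : ℝ} {f : ℝ → H} {v₀ u₀ : H} {v u : ℝ → H}
    (hν : 0 < ν) (hN : 0 < N) (hf : EssBounded f)
    (hγ : 1600 * supNorm f ^ 2 / ν ^ 3 < min (ν * N ^ 2) (2 * μ))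
    (h : IsNudgingSolution ν μ N f v₀ u₀ v u) :
    Tendsto (fun t => ‖v t - u t‖) atTop (𝓝 0) := by
  obtain ⟨v', gv, -, hv1, hv2, hv3⟩ := h.nudged.exists_deriv_grad
  obtain ⟨u', gu, hgu, hu1, hu2, hu3⟩ := h.reference.exists_deriv_grad
  set F := supNorm f with hF
  set γ := min (ν * N ^ 2) (2 * μ) with hγ'
  -- Freezing the time at `0` for negative `t` makes the enstrophy continuous on the whole line, as
  -- the Grönwall lemmas require.
  set D : ℝ → ℝ := fun t => ∑ j, ‖gu j (max t 0)‖ ^ 2 with hD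
  have hDc : Continuous D := by
    have hc : ∀ j, Continuous fun t : ℝ => gu j (max t 0) := fun j =>
      (hgu j).comp_continuous (by fun_prop) fun t => Set.mem_Ici.mpr (le_max_right _ _)
    exact continuous_finsetSum _ fun j _ => (hc j).norm.pow 2
  have hDt : ∀ t, 0 < t → D t = ∑ j, ‖gu j t‖ ^ 2 := fun t ht => by
    simp only [hD, max_eq_left ht.le]
  have hDi : ∀ t, ν * ∫ s in (0 : ℝ)..t, D s = ∫ s in (0 : ℝ)..t, ν * D s := fun t =>
    (intervalIntegral.integral_const_mul _ _).symm
  have hmean : ∀ t, 0 < t → ν * ∫ s in (0 : ℝ)..t, D s ≤ ‖u 0‖ ^ 2 + t * (F ^ 2 / ν) := by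
    intro t ht
    have h1 := norm_sq_le_of_inner_le (w := u) (w' := u') (β := fun t => F ^ 2 / ν - ν * D t)
      (by fun_prop) hu1 hu2 (by
        filter_upwards [hu3, hf.ae_norm_le, ae_restrict_mem measurableSet_Ioi] with s hs hfs hs0
        obtain ⟨hg, a, b, ha, hb, he⟩ := hs
        rw [hDt s hs0]
        exact two_mul_inner_le_of_equation hν hfs hg ha hb he) ht
    rw [intervalIntegral.integral_sub intervalIntegrable_const
      ((hDc.const_mul ν).intervalIntegrable _ _), intervalIntegral.integral_const, ← hDi,
      sub_zero, smul_eq_mul] at h1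
    have h2 := sq_nonneg ‖u t‖
    linarith
  set δ := γ - 1600 * F ^ 2 / ν ^ 3 with hδ
  have hδ0 : 0 < δ := sub_pos.mpr hγ
  have hdecay : ∀ t, 0 < t → ‖v t - u t‖ ^ 2 ≤
      ‖v 0 - u 0‖ ^ 2 * Real.exp (1600 / ν ^ 2 * ‖u 0‖ ^ 2 - δ * t) := by
    intro t ht
    have h1 := norm_sq_le_exp_of_inner_le (w := fun t => v t - u t) (w' := fun t => v' t - u' t)
      (α := fun t => -γ + 1600 / ν * D t) (by fun_prop)
      (fun T hT => (hv1 T hT).sub (hu1 T hT)) (fun t ht => by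
        rcases ht.eq_or_lt with rfl | ht'
        · simp
        · rw [intervalIntegral.integral_sub (hv1 t ht') (hu1 t ht'), hv2 t ht, hu2 t ht]
          abel) (by
        filter_upwards [hv3, hu3, ae_restrict_mem measurableSet_Ioi] with s hs hs' hs0
        obtain ⟨hg, a, b, ha, hb, he⟩ := hs
        obtain ⟨hg', a', b', ha', hb', he'⟩ := hs'
        rw [hDt s hs0]
        exact two_mul_inner_le_of_nudging hν hN hg hg' ha ha' hb hb' he he') ht
    refine h1.trans ?_
    gcongr
    rw [intervalIntegral.integral_add intervalIntegrable_const
      ((hDc.const_mul _).intervalIntegrable _ _), intervalIntegral.integral_const,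
      intervalIntegral.integral_const_mul, sub_zero, smul_eq_mul]
    have h2 := mul_le_mul_of_nonneg_left (hmean t ht) (by positivity : 0 ≤ 1600 / ν ^ 2)
    have h3 : 1600 / ν ^ 2 * (ν * ∫ s in (0 : ℝ)..t, D s) = 1600 / ν * ∫ s in (0 : ℝ)..t, D s := by
      field_simp
    have h4 : 1600 / ν ^ 2 * (‖u 0‖ ^ 2 + t * (F ^ 2 / ν))
        = 1600 / ν ^ 2 * ‖u 0‖ ^ 2 + 1600 * F ^ 2 / ν ^ 3 * t := by
      field_simp
    rw [h3, h4] at h2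
    have h5 : δ * t = γ * t - 1600 * F ^ 2 / ν ^ 3 * t := by rw [hδ]; ring
    rw [h5]
    linarith
  have hlim : Tendsto (fun t => ‖v 0 - u 0‖ ^ 2 *
      Real.exp (1600 / ν ^ 2 * ‖u 0‖ ^ 2 - δ * t)) atTop (𝓝 0) := by
    have h1 : Tendsto (fun t => 1600 / ν ^ 2 * ‖u 0‖ ^ 2 - δ * t) atTop atBot :=
      tendsto_atBot_add_const_left _ _
        (tendsto_neg_atTop_atBot.comp (tendsto_id.const_mul_atTop hδ0))
    simpa using (Real.tendsto_exp_atBot.comp h1).const_mul (‖v 0 - u 0‖ ^ 2)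
  have hsq : Tendsto (fun t => ‖v t - u t‖ ^ 2) atTop (𝓝 0) :=
    squeeze_zero' (Eventually.of_forall fun t => sq_nonneg _)
      ((eventually_gt_atTop 0).mono hdecay) hlim
  have hsqrt := (Real.continuous_sqrt.tendsto 0).comp hsq
  rw [Real.sqrt_zero] at hsqrt
  exact hsqrt.congr fun t => Real.sqrt_sq (norm_nonneg _)

end NSE2D

end

/-! ### Choice of the thresholds -/

theorem mainTheorem11 :
    ∃ (μStar : ℝ → ℝ) (NStar : ℝ × ℝ → ℝ),
      StrictMonoOn μStar (Set.Ioi 0) ∧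
      (∀ N, 0 < N → 0 < μStar N) ∧
      ContinuousOn NStar (Set.Ici 0 ×ˢ Set.Ioi 0) ∧
      (∀ F ν, 0 ≤ F → 0 < ν → 0 < NStar (F, ν)) ∧
      ∀ (ν : ℝ), 0 < ν →
      ∀ (f : ℝ → NSE2D.H), NSE2D.EssBounded f →
      ∀ (N : ℝ), NStar (NSE2D.supNorm f, ν) ≤ N →
      ∀ μ ∈ Set.Icc (μStar (NStar (NSE2D.supNorm f, ν))) (μStar N),
      ∀ (v₀ u₀ : NSE2D.H), NSE2D.MemV v₀ → NSE2D.MemV u₀ →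
      ∀ (v u : ℝ → NSE2D.H), NSE2D.IsNudgingSolution ν μ N f v₀ u₀ v u →
        Tendsto (fun t => ‖v t - u t‖) atTop (𝓝 0) := by
  -- With `μ_*` the identity, the second summand forces `2μ > 1600F²/ν³`. The third, whose square is
  -- `1600F²/ν⁴`, forces `νN² > 1600F²/ν³`. The 1 gives positivity and strictness.
  refine ⟨fun N => N, fun p => 1 + 1600 * p.1 ^ 2 / p.2 ^ 3 + 40 * p.1 / p.2 ^ 2,
    fun _ _ _ _ h => h, fun N hN => hN, ?_, fun F ν hF hν => by positivity, ?_⟩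
  · have h : ∀ p ∈ (Set.Ici 0 ×ˢ Set.Ioi 0 : Set (ℝ × ℝ)), p.2 ≠ 0 := fun p hp => ne_of_gt hp.2
    exact (continuousOn_const.add (ContinuousOn.div (by fun_prop) (by fun_prop)
      fun p hp => pow_ne_zero 3 (h p hp))).add (ContinuousOn.div (by fun_prop) (by fun_prop)
      fun p hp => pow_ne_zero 2 (h p hp))
  · intro ν hν f hf N hN μ hμ v₀ u₀ _ _ v u huv
    have hF := NSE2D.supNorm_nonneg f
    simp only at hN
    have hμ' := hμ.1
    simp only at hμ'
    have ha : 0 ≤ 1600 * NSE2D.supNorm f ^ 2 / ν ^ 3 := by positivity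
    have hb : 0 ≤ 40 * NSE2D.supNorm f / ν ^ 2 := by positivity
    refine huv.tendsto_norm_sub hν (by linarith) hf (lt_min ?_ (by linarith))
    have h1 : 1 + 40 * NSE2D.supNorm f / ν ^ 2 ≤ N := by linarith
    have h2 : (40 * NSE2D.supNorm f / ν ^ 2) ^ 2 < N ^ 2 := by nlinarith
    have h3 := mul_lt_mul_of_pos_left h2 hν
    refine lt_of_eq_of_lt ?_ h3
    field_simp
    ring
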